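/- Let $G$ be a finite abelian group, written additively. A sequence over $G$ is a finite unordered sequence of elements of $G$, repetition allowed. A sequence $S$ over $G$ is called regular if for every proper subgroup $H\subsetneq G$ at most $|H|-1$ terms of $S$ (counted with multiplicity) lie in $H$, and it is called an additive basis of $G$ if every element of $G$ is the sum of a nonempty subsequence of $S$. Let $\mathsf c_0(G)$ be the smallest integer $t\geq 0$ such that every regular sequence over $G$ of length at least $t$ is an additive basis of $G$. Theorem. Let $G\cong C_{n_1}\oplus C_{n_2}$ with $n_1\mid n_2$, where $C_n$ denotes the cyclic group of order $n$, and let $p\geq 3$ be the smallest prime divisor of $|G|$. If $n_1\geq 2p$ and $|G|\geq 72p^6$, then $\mathsf c_0(G)=\frac{|G|}{p}+p-2$. -/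

import Mathlib

/-- The set `∑(S)` of all sums of nonempty subsequences of `S`. A (finite, unordered) sequence
over `G` is a multiset, and its subsequences are its sub-multisets. -/
def subseqSums {G : Type*} [AddCommGroup G] (S : Multiset G) : Set G :=
  {g | ∃ T : Multiset G, T ≤ S ∧ T ≠ 0 ∧ T.sum = g}

/-- `S` is an additive basis of `G`: every element of `G` is the sum of a nonempty
subsequence of `S`. -/
def IsAdditiveBasis {G : Type*} [AddCommGroup G] (S : Multiset G) : Prop :=
  subseqSums S = Set.univ

open Classical in
/-- The subsequence `S_H` of all terms of `S` (with multiplicity) contained in the subgroup `H`. -/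
noncomputable def termsIn {G : Type*} [AddCommGroup G] (S : Multiset G) (H : AddSubgroup G) :
    Multiset G :=
  S.filter (fun g => g ∈ H)

/-- `S` is regular: `|S_H| ≤ |H| - 1` for every proper subgroup `H` of the finite group `G`. -/
def IsRegularSeq {G : Type*} [AddCommGroup G] [Finite G] (S : Multiset G) : Prop :=
  ∀ H : AddSubgroup G, H ≠ ⊤ → (termsIn S H).card ≤ Nat.card H - 1

/-- The lengths `t` such that every regular sequence over `G` of length at least `t` is an
additive basis of `G`. -/
def basisLengths (G : Type*) [AddCommGroup G] [Finite G] : Set ℕ :=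
  {t | ∀ S : Multiset G, IsRegularSeq S → t ≤ S.card → IsAdditiveBasis S}

/-- The invariant `c₀(G)`: the smallest element of `basisLengths G`. -/
noncomputable def c0 (G : Type*) [AddCommGroup G] [Finite G] : ℕ :=
  sInf (basisLengths G)

/-!
The lower bound comes from the nonzero elements of a subgroup of index `p` together with `p - 2`
elements of one further coset: the sums of subsequences miss a coset
(`le_of_mem_basisLengths`).

For the upper bound let `S` be regular with `|S| ≥ |G| / p + p - 2`, let `A = ∑(S) ∪ {0}` be its set
of subsequence sums and `H` the stabilizer of `A`. Each term outside `H` contributes a new coset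
of `H` to `A`, and regularity leaves at most `|H| - 1` terms inside `H`. If `H` were proper and
nontrivial, this would give `|S| ≤ |H| + |G : H| - 3 ≤ |G| / p + p - 3`. So either `A = G` or `A` is
aperiodic (`H = 0`), and the main work is to exclude the latter
(`mul_card_lt_of_stabilizer_eq_bot`). That `0` is also a *nonempty* subsequence sum follows by
applying the same argument to `S` with one term removed, combined with the fact that a zero-sum
free sequence of length `|K| - 1` over `K` forces `K` to be cyclic.

Suppose `A` is aperiodic and call `|∑(T) ∪ {0}| - 1` the gain of a subsequence `T`. By Kneser's
theorem (proved here through Kemperman's union lemma and Dyson's `e`-transform) the gains of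
disjoint subsequences add up to at most `|G| - 1`. Remove subsequences of gain at least `2p` per
term as long as there are any, and let `R` be what remains. Then `R` has only `O(p ^ 3)` distinct
terms, since otherwise it contains a set whose subset sums are all distinct
(`exists_le_ncard_subsums_eq_two_pow`). Let `K` be generated by the terms of multiplicity at least
`4p - 1` in `R`. For every such term `g` the index of `⟨g⟩` in `K` is less than `4p`, since otherwise
copies of `g` and a few other terms have large gain (`card_map_mk'_lt`). Either `K` is cyclic, or
there is `N < 4p` with `N • K ⊆ ⟨g⟩` for all these `g`. In the latter case the terms are grouped into
blocks of at most `N` equal terms with sum in the intersection `C` of the subgroups `⟨g⟩`; as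
`∑(R) ∪ {0}` is aperiodic, there are fewer than `|C|` blocks. In both cases `|R| ≤ n₂ + O(p ^ 4)`,
where `n₂` bounds the orders of the elements. Since `n₁ ≥ 2p + 1`, and since `|G| ≥ 72 p ^ 6` absorbs
the error term, this contradicts the bound on the total gain.
-/

open scoped Pointwise

/-! ### Kneser's addition theorem -/

section Kneser

lemma ncard_coe_addSubgroup {G : Type*} [AddGroup G] (H : AddSubgroup G) :
    (H : Set G).ncard = Nat.card H :=
  (Nat.card_coe_set_eq _).symm

lemma stabilizer_le_stabilizer_add {G : Type*} [AddCommGroup G] (A B : Set G) :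
    AddAction.stabilizer G A ≤ AddAction.stabilizer G (A + B) := by
  intro g hg
  rw [AddAction.mem_stabilizer_iff] at hg ⊢
  rw [← vadd_add_assoc, hg]

variable {G : Type*} [AddCommGroup G] [Finite G]

/-- In a coset of `H₁ + H₂`, the set `A` is a union of `H₁`-cosets and `B` is a union of
`H₂`-cosets, so that `B \ A` is a combinatorial rectangle; every point of it is `x + s + t` for
exactly `|H₁ ⊓ H₂|` pairs `(s, t)`. -/
lemma ncard_mul_ncard_le_card_inf_mul_ncard_diff (A B : Set G) (H₁ H₂ : AddSubgroup G)
    (hA : H₁ ≤ AddAction.stabilizer G A) (hB : H₂ ≤ AddAction.stabilizer G B) (x : G) :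
    {s : G | s ∈ H₁ ∧ x + s ∈ B}.ncard * {t : G | t ∈ H₂ ∧ x + t ∉ A}.ncard ≤
      Nat.card (H₁ ⊓ H₂ : AddSubgroup G) * (B \ A).ncard := by
  classical
  have hA' : ∀ s ∈ H₁, ∀ y, s + y ∈ A ↔ y ∈ A := fun s hs y => by
    simpa using AddAction.mem_stabilizer_set.1 (hA hs) y
  have hB' : ∀ s ∈ H₂, ∀ y, s + y ∈ B ↔ y ∈ B := fun s hs y => by
    simpa using AddAction.mem_stabilizer_set.1 (hB hs) y
  have := Fintype.ofFinite G
  rw [← Set.ncard_prod, Set.ncard_eq_toFinset_card', Set.ncard_eq_toFinset_card']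
  set P := ({s : G | s ∈ H₁ ∧ x + s ∈ B} ×ˢ {t : G | t ∈ H₂ ∧ x + t ∉ A}).toFinset with hP
  have hmem : ∀ q : G × G, q ∈ P ↔ (q.1 ∈ H₁ ∧ x + q.1 ∈ B) ∧ (q.2 ∈ H₂ ∧ x + q.2 ∉ A) := by
    intro q; simp [hP]
  let f : G × G → G := fun q => x + q.1 + q.2
  have h1 : P.card ≤ Nat.card (H₁ ⊓ H₂ : AddSubgroup G) * (P.image f).card := by
    apply Finset.card_le_mul_card_image
    intro z hz
    obtain ⟨q₀, hq₀, rfl⟩ := Finset.mem_image.1 hz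
    rw [hmem] at hq₀
    have : Nat.card (H₁ ⊓ H₂ : AddSubgroup G) =
        ((H₁ ⊓ H₂ : AddSubgroup G) : Set G).toFinset.card := by
      rw [← Set.ncard_eq_toFinset_card', ncard_coe_addSubgroup]
    rw [this]
    apply Finset.card_le_card_of_injOn (fun q => q.1 - q₀.1)
    · intro q hq
      simp only [Finset.coe_filter, Set.mem_ofPred_eq, hmem, f] at hq
      obtain ⟨⟨⟨h1, -⟩, h2, -⟩, h3⟩ := hq
      have h4 : q.1 - q₀.1 = q₀.2 - q.2 := by
        rw [sub_eq_sub_iff_add_eq_add]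
        have : x + (q.1 + q.2) = x + (q₀.1 + q₀.2) := by rw [← add_assoc, h3, add_assoc]
        rw [add_left_cancel this]; abel
      simp only [Set.coe_toFinset, SetLike.mem_coe, AddSubgroup.mem_inf]
      exact ⟨H₁.sub_mem h1 hq₀.1.1, h4 ▸ H₂.sub_mem hq₀.2.1 h2⟩
    · intro q hq q' hq' h
      simp only [Finset.coe_filter, Set.mem_ofPred_eq, f] at hq hq'
      have h1 : q.1 = q'.1 := by simpa using h
      have h2 : x + q.1 + q.2 = x + q'.1 + q'.2 := hq.2.trans hq'.2.symm
      rw [h1] at h2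
      exact Prod.ext h1 (add_left_cancel h2)
  refine h1.trans (Nat.mul_le_mul_left _ (Finset.card_le_card ?_))
  intro z hz
  obtain ⟨q, hq, rfl⟩ := Finset.mem_image.1 hz
  rw [hmem] at hq
  obtain ⟨⟨h1, h2⟩, h3, h4⟩ := hq
  simp only [Set.toFinset_sdiff, Finset.mem_sdiff, Set.mem_toFinset, f]
  constructor
  · rw [add_comm, hB' _ h3]; exact h2
  · rw [add_right_comm, add_comm, hA' _ h1]; exact h4

/-- A nonempty part of `H₁` cut out by a condition invariant under `H₂` contains a coset of
`H₁ ⊓ H₂`. -/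
lemma card_inf_le_ncard_of_stable (H₁ H₂ : AddSubgroup G) (P : G → Prop)
    (hP : ∀ t ∈ H₂, ∀ y, P y → P (t + y)) (x s : G) (hs : s ∈ H₁) (hxs : P (x + s)) :
    Nat.card (H₁ ⊓ H₂ : AddSubgroup G) ≤ {s : G | s ∈ H₁ ∧ P (x + s)}.ncard := by
  rw [← ncard_coe_addSubgroup]
  refine Set.ncard_le_ncard_of_injOn (fun u => u + s) ?_ ?_ (Set.toFinite _)
  · intro u hu
    refine ⟨H₁.add_mem hu.1 hs, ?_⟩
    rw [add_left_comm]
    exact hP u hu.2 _ hxs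
  · intro u _ v _ h
    exact add_right_cancel h

/-- The numerical core of the union lemma: in an `h₁ × h₂` grid a proper rectangle and the
opposite one cannot both be small. -/
lemma le_of_rectangle_bounds {j w w' u u' h₁ h₂ d₁ d₂ : ℕ} (hj : 0 < j) (hw : j ≤ w) (hu : j ≤ u)
    (hw' : w' = 0 ∨ j ≤ w') (hu' : u' = 0 ∨ j ≤ u') (hww : w + w' = h₁) (huu : u + u' = h₂)
    (h2 : w * u ≤ j * d₂) (h1 : w' * u' ≤ j * d₁) (hd₂ : d₂ + j < h₁) (hd₁ : d₁ + j < h₂) :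
    h₂ ≤ d₂ := by
  rcases hw' with rfl | hw'
  · have : j * w ≤ j * d₂ := by nlinarith
    have := Nat.le_of_mul_le_mul_left this hj
    omega
  rcases hu' with rfl | hu'
  · have : j * u ≤ j * d₂ := by nlinarith
    have := Nat.le_of_mul_le_mul_left this hj
    omega
  exfalso
  obtain ⟨α, rfl⟩ := Nat.exists_eq_add_of_le hw
  obtain ⟨β, rfl⟩ := Nat.exists_eq_add_of_le hu
  obtain ⟨a, rfl⟩ := Nat.exists_eq_add_of_le hw'
  obtain ⟨b, rfl⟩ := Nat.exists_eq_add_of_le hu'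
  have e1 : d₂ < j + α + a := by omega
  have e2 : d₁ < j + β + b := by omega
  have e3 : j * d₂ < j * (j + α + a) := Nat.mul_lt_mul_of_pos_left e1 hj
  have e4 : j * d₁ < j * (j + β + b) := Nat.mul_lt_mul_of_pos_left e2 hj
  nlinarith [Nat.zero_le (α * β), Nat.zero_le (a * b)]

/-- Kemperman's union lemma. -/
lemma min_le_ncard_union_add_card_stabilizer (A B : Set G) :
    min (A.ncard + Nat.card (AddAction.stabilizer G A))
        (B.ncard + Nat.card (AddAction.stabilizer G B)) ≤
      (A ∪ B).ncard + Nat.card (AddAction.stabilizer G (A ∪ B)) := by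
  classical
  by_cases hAB : A ⊆ B
  · rw [Set.union_eq_self_of_subset_left hAB]; exact min_le_right _ _
  by_cases hBA : B ⊆ A
  · rw [Set.union_eq_self_of_subset_right hBA]; exact min_le_left _ _
  obtain ⟨c', hc'A, hc'B⟩ := Set.not_subset.1 hAB
  obtain ⟨c, hcB, hcA⟩ := Set.not_subset.1 hBA
  set H₁ := AddAction.stabilizer G A with hH₁
  set H₂ := AddAction.stabilizer G B with hH₂
  have hA' : ∀ s ∈ H₁, ∀ y, s + y ∈ A ↔ y ∈ A := fun s hs y => by
    simpa using AddAction.mem_stabilizer_set.1 hs y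
  have hB' : ∀ s ∈ H₂, ∀ y, s + y ∈ B ↔ y ∈ B := fun s hs y => by
    simpa using AddAction.mem_stabilizer_set.1 hs y
  set j := Nat.card (H₁ ⊓ H₂ : AddSubgroup G) with hj
  have hjpos : 0 < j := Nat.card_pos
  have hj' : Nat.card (H₂ ⊓ H₁ : AddSubgroup G) = j := by rw [inf_comm]
  have hstab : j ≤ Nat.card (AddAction.stabilizer G (A ∪ B)) :=
    AddSubgroup.card_le_of_le AddAction.stabilizer_inf_stabilizer_le_stabilizer_union
  have hU1 : (A ∪ B).ncard = A.ncard + (B \ A).ncard := by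
    rw [← Set.union_sdiff_self, Set.ncard_union_eq Set.disjoint_sdiff_right]
  have hU2 : (A ∪ B).ncard = B.ncard + (A \ B).ncard := by
    rw [Set.union_comm, ← Set.union_sdiff_self, Set.ncard_union_eq Set.disjoint_sdiff_right]
  have split : ∀ (H : AddSubgroup G) (P : G → Prop) (x : G),
      {s : G | s ∈ H ∧ P (x + s)}.ncard + {s : G | s ∈ H ∧ ¬ P (x + s)}.ncard = Nat.card H := by
    intro H P x
    rw [← ncard_coe_addSubgroup, ← Set.ncard_union_eq]
    · congr 1; ext s; by_cases h : P (x + s) <;> simp [h]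
    · rw [Set.disjoint_left]; rintro s ⟨-, h⟩ ⟨-, h'⟩; exact h' h
  have dich : ∀ (H H' : AddSubgroup G) (P : G → Prop) (x : G),
      (∀ t ∈ H', ∀ y, P y → P (t + y)) → ({s : G | s ∈ H ∧ P (x + s)}.ncard = 0 ∨
        Nat.card (H ⊓ H' : AddSubgroup G) ≤ {s : G | s ∈ H ∧ P (x + s)}.ncard) := by
    intro H H' P x hP
    rcases Set.eq_empty_or_nonempty {s : G | s ∈ H ∧ P (x + s)} with h | ⟨s, hs, hxs⟩
    · left; rw [h, Set.ncard_empty]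
    · right; exact card_inf_le_ncard_of_stable H H' P hP x s hs hxs
  by_contra! hcon
  obtain ⟨hc1, hc2⟩ := lt_min_iff.1 hcon
  have hd₂ : (B \ A).ncard + j < Nat.card H₁ := by omega
  have hd₁ : (A \ B).ncard + j < Nat.card H₂ := by omega
  have key1 : Nat.card H₂ ≤ (B \ A).ncard := by
    refine le_of_rectangle_bounds (j := j) hjpos ?_ ?_ ?_ ?_ (split H₁ (· ∈ B) c)
      ((add_comm _ _).trans (split H₂ (· ∈ A) c))
      (ncard_mul_ncard_le_card_inf_mul_ncard_diff A B H₁ H₂ le_rfl le_rfl c) ?_ hd₂ hd₁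
    · exact card_inf_le_ncard_of_stable H₁ H₂ (· ∈ B) (fun t ht y hy => (hB' t ht y).2 hy) c 0
        H₁.zero_mem (by simpa using hcB)
    · rw [← hj']
      exact card_inf_le_ncard_of_stable H₂ H₁ (· ∉ A) (fun t ht y hy => by rwa [hA' t ht y]) c 0
        H₂.zero_mem (by simpa using hcA)
    · exact dich H₁ H₂ (· ∉ B) c (fun t ht y hy => by rwa [hB' t ht y])
    · rw [← hj']
      exact dich H₂ H₁ (· ∈ A) c (fun t ht y hy => by rwa [hA' t ht y])
    · rw [mul_comm, ← hj']
      exact ncard_mul_ncard_le_card_inf_mul_ncard_diff B A H₂ H₁ le_rfl le_rfl c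
  have key2 : Nat.card H₁ ≤ (A \ B).ncard := by
    refine le_of_rectangle_bounds (j := j) hjpos ?_ ?_ ?_ ?_ (split H₂ (· ∈ A) c')
      ((add_comm _ _).trans (split H₁ (· ∈ B) c'))
      (hj' ▸ ncard_mul_ncard_le_card_inf_mul_ncard_diff B A H₂ H₁ le_rfl le_rfl c') ?_ hd₁ hd₂
    · rw [← hj']
      exact card_inf_le_ncard_of_stable H₂ H₁ (· ∈ A) (fun t ht y hy => (hA' t ht y).2 hy) c' 0
        H₂.zero_mem (by simpa using hc'A)
    · exact card_inf_le_ncard_of_stable H₁ H₂ (· ∉ B) (fun t ht y hy => by rwa [hB' t ht y]) c' 0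
        H₁.zero_mem (by simpa using hc'B)
    · rw [← hj']
      exact dich H₂ H₁ (· ∉ A) c' (fun t ht y hy => by rwa [hA' t ht y])
    · exact dich H₁ H₂ (· ∈ B) c' (fun t ht y hy => by rwa [hB' t ht y])
    · rw [mul_comm]
      exact ncard_mul_ncard_le_card_inf_mul_ncard_diff A B H₁ H₂ le_rfl le_rfl c'
  omega

/-- Each sum `a + b` lies in a subset of `A + B` that satisfies Kneser's bound; it is found by
Dyson's `e`-transforms, which shrink `B` until `B - b` stabilizes `A`. -/
lemma exists_subset_add_of_mem (A B : Set G) (a b : G) (ha : a ∈ A) (hb : b ∈ B) :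
    ∃ C ⊆ A + B, a + b ∈ C ∧
      A.ncard + B.ncard ≤ C.ncard + Nat.card (AddAction.stabilizer G C) := by
  induction hn : B.ncard using Nat.strong_induction_on generalizing A B with
  | _ n ih =>
    subst hn
    by_cases h : ∀ x ∈ A, ∀ y ∈ B, x + (y - b) ∈ A
    · refine ⟨A + {b}, Set.add_subset_add_left (by simpa using hb), Set.add_mem_add ha rfl, ?_⟩
      have h1 : (A + {b}).ncard = A.ncard := by
        rw [Set.add_singleton]
        exact Set.ncard_image_of_injective _ (add_left_injective b)
      have h2 : B.ncard ≤ Nat.card (AddAction.stabilizer G (A + {b})) := by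
        rw [← ncard_coe_addSubgroup]
        refine Set.ncard_le_ncard_of_injOn (fun y => y - b) ?_ ?_ (Set.toFinite _)
        · intro y hy
          refine stabilizer_le_stabilizer_add _ _ ?_
          rw [AddAction.mem_stabilizer_set' (Set.toFinite A)]
          intro x hx
          rw [vadd_eq_add, add_comm]
          exact h x hx y hy
        · intro y _ z _ hyz
          simpa using hyz
      omega
    · push Not at h
      obtain ⟨x, hx, y, hy, hxy⟩ := h
      set e := x - b with he
      let A' : Set G := A ∪ (e +ᵥ B)
      let B' : Set G := {z ∈ B | e + z ∈ A}
      have hB'B : B' ⊆ B := fun z hz => hz.1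
      have hyB' : y ∉ B' := fun hz => hxy (by
        have := hz.2
        rwa [he, sub_add_eq_add_sub, add_sub_assoc] at this)
      have hlt : B'.ncard < B.ncard :=
        Set.ncard_lt_ncard ⟨hB'B, fun hh => hyB' (hh hy)⟩
      have hbB' : b ∈ B' := ⟨hb, by simpa [he] using hx⟩
      obtain ⟨C, hC, habC, hcard⟩ := ih _ hlt A' B' (Or.inl ha) hbB' rfl
      refine ⟨C, hC.trans ?_, habC, ?_⟩
      · rintro _ ⟨u, hu, z, hz, rfl⟩
        rcases hu with hu | ⟨v, hv, rfl⟩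
        · exact Set.add_mem_add hu hz.1
        · refine ⟨e + z, hz.2, v, hv, ?_⟩
          simp only [vadd_eq_add]; abel
      · have h1 : A'.ncard + (A ∩ (e +ᵥ B)).ncard = A.ncard + (e +ᵥ B).ncard :=
          Set.ncard_union_add_ncard_inter _ _
        have h2 : (e +ᵥ B).ncard = B.ncard :=
          Set.ncard_image_of_injective _ (add_right_injective e)
        have h3 : (A ∩ (e +ᵥ B)) = e +ᵥ B' := by
          ext z; constructor
          · rintro ⟨hz, v, hv, rfl⟩
            exact ⟨v, ⟨hv, hz⟩, rfl⟩
          · rintro ⟨v, hv, rfl⟩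
            exact ⟨hv.2, v, hv.1, rfl⟩
        have h4 : (e +ᵥ B').ncard = B'.ncard :=
          Set.ncard_image_of_injective _ (add_right_injective e)
        rw [h3] at h1
        omega

/-- Kneser's theorem: `|A + B| ≥ |A| + |B| - |H|` with `H` the stabilizer of `A + B`. -/
theorem ncard_add_ncard_le_ncard_add_add_card_stabilizer {A B : Set G} (hA : A.Nonempty)
    (hB : B.Nonempty) :
    A.ncard + B.ncard ≤ (A + B).ncard + Nat.card (AddAction.stabilizer G (A + B)) := by
  have key : ∀ F : Set G, F.Finite → F ⊆ A + B → F.Nonempty → ∃ C ⊆ A + B, F ⊆ C ∧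
      A.ncard + B.ncard ≤ C.ncard + Nat.card (AddAction.stabilizer G C) := by
    intro F hF
    induction F, hF using Set.Finite.induction_on with
    | empty => intro _ h; exact absurd h Set.not_nonempty_empty
    | @insert x F hx _ ih =>
      intro hsub _
      obtain ⟨a, ha, b, hb, hab⟩ := hsub (Set.mem_insert _ _)
      obtain ⟨C, hC, hxC, hCc⟩ := exists_subset_add_of_mem A B a b ha hb
      have hab : a + b = x := hab
      rw [hab] at hxC
      rcases F.eq_empty_or_nonempty with rfl | hFne
      · exact ⟨C, hC, by simpa using hxC, hCc⟩
      · obtain ⟨D, hD, hFD, hDc⟩ := ih ((Set.subset_insert _ _).trans hsub) hFne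
        refine ⟨C ∪ D, Set.union_subset hC hD,
          Set.insert_subset (Or.inl hxC) (hFD.trans Set.subset_union_right), ?_⟩
        exact (le_min hCc hDc).trans (min_le_ncard_union_add_card_stabilizer C D)
  obtain ⟨C, hC, hC', h⟩ := key (A + B) (Set.toFinite _) le_rfl (hA.add hB)
  rwa [hC.antisymm hC'] at h

end Kneser

/-! ### Subsequence sums, including the empty one -/

section Subsums

variable {G : Type*} [AddCommGroup G]

/-- The set `∑(S) ∪ {0}` of sums of all subsequences of `S`, the empty one included. -/
def subsums (S : Multiset G) : Set G := {x | ∃ U ≤ S, U.sum = x}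

lemma zero_mem_subsums (S : Multiset G) : (0 : G) ∈ subsums S := ⟨0, Multiset.zero_le _, by simp⟩

lemma subsums_nonempty (S : Multiset G) : (subsums S).Nonempty := ⟨0, zero_mem_subsums S⟩

lemma subsums_mono {S T : Multiset G} (h : S ≤ T) : subsums S ⊆ subsums T := by
  rintro x ⟨U, hU, rfl⟩; exact ⟨U, hU.trans h, rfl⟩

@[simp] lemma subsums_zero : subsums (0 : Multiset G) = 0 := by
  ext x; simp only [subsums, nonpos_iff_eq_zero, exists_eq_left, Multiset.sum_zero]
  simp [eq_comm]

lemma subsums_add (S T : Multiset G) : subsums (S + T) = subsums S + subsums T := by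
  classical
  ext x; constructor
  · rintro ⟨U, hU, rfl⟩
    refine ⟨_, ⟨U ∩ S, Multiset.inter_le_right, rfl⟩, _, ⟨U - S, ?_, rfl⟩, ?_⟩
    · rw [tsub_le_iff_left]; exact hU
    · simp only
      rw [← Multiset.sum_add, add_comm, Multiset.sub_add_inter]
  · rintro ⟨_, ⟨U, hU, rfl⟩, _, ⟨V, hV, rfl⟩, rfl⟩
    exact ⟨U + V, add_le_add hU hV, by simp⟩

/-- `subsums` as a homomorphism to the monoid of sets under pointwise addition. -/
def subsumsHom (G : Type*) [AddCommGroup G] : Multiset G →+ Set G where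
  toFun := subsums
  map_zero' := subsums_zero
  map_add' := subsums_add

lemma subsums_singleton (a : G) : subsums ({a} : Multiset G) = {0, a} := by
  ext x
  simp only [subsums, Multiset.le_singleton, Set.mem_ofPred_eq, Set.mem_insert_iff,
    Set.mem_singleton_iff]
  constructor
  · rintro ⟨U, rfl | rfl, rfl⟩ <;> simp
  · rintro (rfl | rfl)
    · exact ⟨0, Or.inl rfl, rfl⟩
    · exact ⟨{x}, Or.inr rfl, by simp⟩

lemma subsums_cons (a : G) (S : Multiset G) :
    subsums (a ::ₘ S) = subsums S ∪ (a +ᵥ subsums S) := by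
  rw [← Multiset.singleton_add, subsums_add, subsums_singleton, Set.insert_eq, Set.union_add,
    Set.singleton_add, Set.singleton_add]
  simp [← Set.image_vadd]

lemma subsums_map {H : Type*} [AddCommGroup H] (f : G →+ H) (S : Multiset G) :
    subsums (S.map f) = f '' subsums S := by
  induction S using Multiset.induction_on with
  | empty => simp [← Set.singleton_zero]
  | cons a S ih =>
    rw [Multiset.map_cons, subsums_cons, subsums_cons, ih, Set.image_union]
    congr 1
    ext x; simp [Set.mem_vadd_set]

lemma subsums_replicate (n : ℕ) (g : G) :
    subsums (Multiset.replicate n g) = {x | ∃ i ≤ n, i • g = x} := by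
  ext x; constructor
  · rintro ⟨U, hU, rfl⟩
    obtain ⟨i, hi, rfl⟩ := Multiset.le_replicate_iff.1 hU
    exact ⟨i, hi, by simp⟩
  · rintro ⟨i, hi, rfl⟩
    exact ⟨Multiset.replicate i g, Multiset.replicate_le_replicate g |>.2 hi, by simp⟩

lemma subsums_subset_of_forall_mem {S : Multiset G} (H : AddSubgroup G) (h : ∀ x ∈ S, x ∈ H) :
    subsums S ⊆ H := by
  rintro x ⟨U, hU, rfl⟩
  exact AddSubgroup.multiset_sum_mem _ _ fun y hy => h y (Multiset.mem_of_le hU hy)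

lemma stabilizer_subsums_mono {S T : Multiset G} (h : S ≤ T) :
    AddAction.stabilizer G (subsums S) ≤ AddAction.stabilizer G (subsums T) := by
  obtain ⟨R, rfl⟩ := Multiset.le_iff_exists_add.1 h
  rw [subsums_add]; exact stabilizer_le_stabilizer_add _ _

lemma stabilizer_subsums_le_of_eq_add {S T : Multiset G} (X : Set G)
    (h : subsums T = subsums S + X) :
    AddAction.stabilizer G (subsums S) ≤ AddAction.stabilizer G (subsums T) := by
  rw [h]; exact stabilizer_le_stabilizer_add _ _

lemma stabilizer_le_subsums (S : Multiset G) :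
    (AddAction.stabilizer G (subsums S) : Set G) ⊆ subsums S := by
  intro x hx
  have := (AddAction.mem_stabilizer_set.1 hx 0).2 (zero_mem_subsums S)
  simpa using this

lemma ncard_eq_card_mul_ncard_image_mk (H : AddSubgroup G) (A : Set G)
    (hA : H ≤ AddAction.stabilizer G A) :
    A.ncard = Nat.card H * (QuotientAddGroup.mk '' A : Set (G ⧸ H)).ncard := by
  have h1 : A = QuotientAddGroup.mk ⁻¹' (QuotientAddGroup.mk '' A : Set (G ⧸ H)) := by
    refine (Set.subset_preimage_image _ _).antisymm ?_
    rintro x ⟨y, hy, hxy⟩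
    rw [QuotientAddGroup.eq] at hxy
    have := (AddAction.mem_stabilizer_set.1 (hA hxy) y).2 hy
    simpa using this
  conv_lhs => rw [h1]
  rw [← Nat.card_coe_set_eq,
    Nat.card_congr (QuotientAddGroup.preimageMkEquivAddSubgroupProdSet H _), Nat.card_prod,
    Nat.card_coe_set_eq]

open Classical in
lemma subsums_map_mk_filter_notMem (H : AddSubgroup G) (S : Multiset G) :
    subsums ((S.filter (· ∉ H)).map (QuotientAddGroup.mk' H)) =
      QuotientAddGroup.mk' H '' subsums S := by
  rw [← subsums_map]
  conv_rhs => rw [← Multiset.filter_add_not (· ∈ H) S, Multiset.map_add, subsums_add]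
  have h : (S.filter (· ∈ H)).map (QuotientAddGroup.mk' H) =
      Multiset.replicate (S.filter (· ∈ H)).card 0 := by
    rw [Multiset.eq_replicate]
    refine ⟨by simp, fun b hb => ?_⟩
    obtain ⟨x, hx, rfl⟩ := Multiset.mem_map.1 hb
    simpa using (Multiset.mem_filter.1 hx).2
  have h0 : subsums (Multiset.replicate (S.filter (· ∈ H)).card (0 : G ⧸ H)) = 0 := by
    rw [subsums_replicate]; ext x; simp [eq_comm]; intro _; exact ⟨0, Nat.zero_le _⟩
  rw [h, h0, zero_add]

lemma ncard_subsums_replicate {n : ℕ} {g : G} (h : n + 1 ≤ addOrderOf g) :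
    (subsums (Multiset.replicate n g)).ncard = n + 1 := by
  have h1 : subsums (Multiset.replicate n g) =
      (fun i => i • g) '' (Finset.range (n + 1) : Set ℕ) := by
    rw [subsums_replicate]; ext x; simp
  rw [h1, Set.InjOn.ncard_image, Set.ncard_coe_finset, Finset.card_range]
  intro i hi j hj hij
  simp only [Finset.coe_range, Set.mem_Iio] at hi hj
  exact nsmul_injOn_Iio_addOrderOf (Set.mem_Iio.2 (by omega)) (Set.mem_Iio.2 (by omega)) hij

variable [Finite G]

lemma mem_stabilizer_subsums_of_ncard_cons_le {a : G} {S : Multiset G}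
    (h : (subsums (a ::ₘ S)).ncard ≤ (subsums S).ncard) :
    a ∈ AddAction.stabilizer G (subsums S) := by
  have h1 : subsums S = subsums (a ::ₘ S) :=
    Set.eq_of_subset_of_ncard_le (subsums_mono (Multiset.le_cons_self _ _)) h
  rw [AddAction.mem_stabilizer_set' (Set.toFinite _)]
  intro b hb
  rw [h1, subsums_cons]
  exact Or.inr ⟨b, hb, rfl⟩

/-- Each term outside the stabilizer of `subsums T` enlarges the set of subsequence sums. -/
lemma card_add_one_le_ncard_subsums (T : Multiset G)
    (h : ∀ t ∈ T, t ∉ AddAction.stabilizer G (subsums T)) :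
    T.card + 1 ≤ (subsums T).ncard := by
  induction T using Multiset.induction_on with
  | empty => simp [← Set.singleton_zero]
  | cons a S ih =>
    have hle := stabilizer_subsums_mono (Multiset.le_cons_self S a)
    have h1 := ih fun t ht h' => h t (Multiset.mem_cons_of_mem ht) (hle h')
    have h2 : ¬ (subsums (a ::ₘ S)).ncard ≤ (subsums S).ncard := fun h' =>
      h a (Multiset.mem_cons_self _ _) (hle (mem_stabilizer_subsums_of_ncard_cons_le h'))
    rw [Multiset.card_cons]; omega

lemma card_add_one_le_ncard_subsums_of_stabilizer_eq_bot {T : Multiset G} (h0 : (0 : G) ∉ T)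
    (h : AddAction.stabilizer G (subsums T) = ⊥) : T.card + 1 ≤ (subsums T).ncard := by
  refine card_add_one_le_ncard_subsums T fun t ht h' => h0 ?_
  rw [h, AddSubgroup.mem_bot] at h'
  exact h' ▸ ht

/-- Kneser's theorem for sequences whose set of subsequence sums is aperiodic. -/
lemma ncard_subsums_add_ncard_subsums_le {S T : Multiset G}
    (h : AddAction.stabilizer G (subsums (S + T)) = ⊥) :
    (subsums S).ncard + (subsums T).ncard ≤ (subsums (S + T)).ncard + 1 := by
  have := ncard_add_ncard_le_ncard_add_add_card_stabilizer (subsums_nonempty S) (subsums_nonempty T)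
  rw [subsums_add] at h ⊢
  rwa [h, AddSubgroup.card_bot] at this

open Classical in
/-- With `H` the stabilizer of `subsums S`, every term of `S` outside `H` contributes at least
one further `H`-coset to `subsums S`. -/
lemma card_stabilizer_mul_le_ncard_subsums (S : Multiset G) :
    Nat.card (AddAction.stabilizer G (subsums S)) *
        ((S.filter (· ∉ AddAction.stabilizer G (subsums S))).card + 1) ≤ (subsums S).ncard := by
  set H := AddAction.stabilizer G (subsums S) with hH
  rw [ncard_eq_card_mul_ncard_image_mk H (subsums S) le_rfl]
  refine Nat.mul_le_mul_left _ ?_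
  have h1 := subsums_map_mk_filter_notMem H S
  have h2 : AddAction.stabilizer (G ⧸ H) (QuotientAddGroup.mk' H '' subsums S) = ⊥ :=
    AddAction.stabilizer_image_coe_quotient _
  rw [← h1] at h2
  have h3 := card_add_one_le_ncard_subsums_of_stabilizer_eq_bot ?_ h2
  · rw [h1, Multiset.card_map] at h3
    exact h3
  · intro h0
    obtain ⟨x, hx, hx0⟩ := Multiset.mem_map.1 h0
    exact (Multiset.mem_filter.1 hx).2 ((QuotientAddGroup.eq_zero_iff x).1 hx0)

/-- Translates of `X` by a subset `P` of a subgroup `H` are counted coset by coset. -/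
lemma ncard_mul_ncard_image_mk_le (H : AddSubgroup G) (P X : Set G) (hP : P ⊆ H) :
    P.ncard * (QuotientAddGroup.mk' H '' X).ncard ≤ (P + X).ncard := by
  choose! r hr using fun y (hy : y ∈ QuotientAddGroup.mk' H '' X) => hy
  rw [← Set.ncard_prod]
  refine Set.ncard_le_ncard_of_injOn (fun q => q.1 + r q.2) ?_ ?_ (Set.toFinite _)
  · rintro ⟨a, y⟩ ⟨ha, hy⟩
    exact Set.add_mem_add ha (hr y hy).1
  · rintro ⟨a, y⟩ ⟨ha, hy⟩ ⟨b, z⟩ ⟨hb, hz⟩ h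
    have h' : a + r y = b + r z := h
    have e := congrArg (QuotientAddGroup.mk' H) h'
    have ha0 : QuotientAddGroup.mk' H a = 0 := (QuotientAddGroup.eq_zero_iff a).2 (hP ha)
    have hb0 : QuotientAddGroup.mk' H b = 0 := (QuotientAddGroup.eq_zero_iff b).2 (hP hb)
    rw [map_add, map_add, (hr y hy).2, (hr z hz).2, ha0, hb0, zero_add, zero_add] at e
    subst e
    simpa using h'

/-- `addOrderOf g - 1` copies of `g` already sum to all of `⟨g⟩`. -/
lemma subsums_replicate_eq_zmultiples {n : ℕ} {g : G} (h : addOrderOf g ≤ n + 1) :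
    subsums (Multiset.replicate n g) = AddSubgroup.zmultiples g := by
  rw [subsums_replicate]
  ext x
  simp only [Set.mem_ofPred_eq, SetLike.mem_coe]
  constructor
  · rintro ⟨i, -, rfl⟩; exact nsmul_mem (AddSubgroup.mem_zmultiples g) i
  · classical
    intro hx
    rw [← mem_multiples_iff_mem_zmultiples, mem_multiples_iff_mem_range_addOrderOf] at hx
    obtain ⟨i, hi, rfl⟩ := Finset.mem_image.1 hx
    exact ⟨i, by have := Finset.mem_range.1 hi; omega, rfl⟩

end Subsums

/-! ### Many distinct terms -/

section Dissociated

variable {G : Type*} [AddCommGroup G] [Finite G]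

/-- Choosing terms greedily outside the difference set `subsums T - subsums T`, which has at most
`3 ^ |T|` elements, gives a subset all of whose subset sums are distinct. -/
lemma exists_le_ncard_subsums_eq_two_pow (X : Finset G) (n : ℕ)
    (hX : 3 ^ n < 3 * X.card ∨ n = 0) :
    ∃ T ≤ X.val, T.card = n ∧ (subsums T).ncard = 2 ^ n ∧
      (subsums T - subsums T).ncard ≤ 3 ^ n := by
  induction n with
  | zero => exact ⟨0, Multiset.zero_le _, by simp [← Set.singleton_zero]⟩
  | succ n ih =>
    have hX2 : 3 ^ n < X.card := by
      rcases hX with h | h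
      · rw [pow_succ] at h; omega
      · omega
    obtain ⟨T, hTX, hT, hT2, hT3⟩ := ih (Or.inl (by omega))
    obtain ⟨x, hxX, hxD⟩ : ∃ x ∈ (X : Set G), x ∉ subsums T - subsums T :=
      Set.exists_mem_notMem_of_ncard_lt_ncard (by rw [Set.ncard_coe_finset]; omega)
    have hxT : x ∉ T := fun h => hxD ⟨x, ⟨{x}, by simpa using h, by simp⟩, 0, zero_mem_subsums _,
      by simp⟩
    refine ⟨x ::ₘ T, ?_, by simp [hT], ?_, ?_⟩
    · rw [Multiset.le_iff_subset (Multiset.nodup_cons.2 ⟨hxT, Multiset.nodup_of_le hTX X.nodup⟩)]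
      intro y hy
      rcases Multiset.mem_cons.1 hy with rfl | hy
      · exact hxX
      · exact Multiset.mem_of_le hTX hy
    · rw [subsums_cons, Set.ncard_union_eq, pow_succ, mul_two, hT2]
      · rw [show (x +ᵥ subsums T).ncard = (subsums T).ncard from
          Set.ncard_image_of_injective _ (add_right_injective x), hT2]
      · rw [Set.disjoint_left]
        rintro y hy ⟨z, hz, rfl⟩
        exact hxD ⟨_, hy, z, hz, by simp⟩
    · have hsub : subsums (x ::ₘ T) - subsums (x ::ₘ T) ⊆
          (subsums T - subsums T) ∪ ((fun y => x + y) '' (subsums T - subsums T) ∪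
            (fun y => -x + y) '' (subsums T - subsums T)) := by
        rintro _ ⟨a, ha, b, hb, rfl⟩
        rw [subsums_cons] at ha hb
        rcases ha with ha | ⟨a, ha, rfl⟩ <;> rcases hb with hb | ⟨b, hb, rfl⟩
        · exact Or.inl ⟨a, ha, b, hb, rfl⟩
        · exact Or.inr (Or.inr ⟨a - b, ⟨a, ha, b, hb, rfl⟩, by simp only [vadd_eq_add]; abel⟩)
        · exact Or.inr (Or.inl ⟨a - b, ⟨a, ha, b, hb, rfl⟩, by simp only [vadd_eq_add]; abel⟩)
        · exact Or.inl ⟨a, ha, b, hb, by simp⟩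
      have e1 := Set.ncard_le_ncard hsub (Set.toFinite _)
      have e2 := Set.ncard_union_le (subsums T - subsums T)
        ((fun y => x + y) '' (subsums T - subsums T) ∪
            (fun y => -x + y) '' (subsums T - subsums T))
      have e3 := Set.ncard_union_le ((fun y => x + y) '' (subsums T - subsums T))
            ((fun y => -x + y) '' (subsums T - subsums T))
      rw [Set.ncard_image_of_injective _ (add_right_injective x),
        Set.ncard_image_of_injective _ (add_right_injective (-x))] at e3
      rw [pow_succ]; omega

end Dissociated

/-! ### Terms of high multiplicity -/

section HighMultiplicity

variable {G : Type*} [AddCommGroup G]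

lemma card_mul_card_map_mk' {H K : AddSubgroup G} (h : H ≤ K) :
    Nat.card H * Nat.card (K.map (QuotientAddGroup.mk' H)) = Nat.card K := by
  have := ncard_eq_card_mul_ncard_image_mk H (K : Set G) (by
    intro x hx
    rw [AddAction.mem_stabilizer_set]
    intro b
    exact K.add_mem_cancel_left (h hx))
  rw [ncard_coe_addSubgroup] at this
  rw [this, ← ncard_coe_addSubgroup (K.map _)]
  rfl

lemma card_map_mk'_nsmul_mem (H K : AddSubgroup G) {x : G} (hx : x ∈ K) :
    Nat.card (K.map (QuotientAddGroup.mk' H)) • x ∈ H := by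
  rw [← QuotientAddGroup.eq_zero_iff]
  have h1 : QuotientAddGroup.mk' H x ∈ K.map (QuotientAddGroup.mk' H) :=
    AddSubgroup.mem_map_of_mem _ hx
  have := AddSubgroup.addOrderOf_dvd_natCard _ h1
  rw [addOrderOf_dvd_iff_nsmul_eq_zero] at this
  simpa using this

/-- An interval of multiples of `g` is a sum of multiples of `f • g` and a shorter interval, as
soon as the latter has at least `f` elements. -/
lemma subsums_replicate_eq_add (g : G) {f w v : ℕ} (h : f * w + f ≤ v + 1) :
    subsums (Multiset.replicate v g) =
      subsums (Multiset.replicate w (f • g)) + subsums (Multiset.replicate (v - f * w) g) := by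
  rw [subsums_replicate, subsums_replicate, subsums_replicate]
  ext x; constructor
  · rintro ⟨i, hi, rfl⟩
    rcases Nat.eq_zero_or_pos f with rfl | hf
    · exact ⟨0, ⟨0, by simp⟩, i • g, ⟨i, by simpa using hi, rfl⟩, by simp⟩
    refine ⟨_, ⟨min w (i / f), min_le_left _ _, rfl⟩, _, ⟨i - f * min w (i / f), ?_, rfl⟩, ?_⟩
    · rcases le_total w (i / f) with hw | hw
      · rw [min_eq_left hw]; omega
      · rw [min_eq_right hw]
        have := Nat.div_add_mod i f
        have := Nat.mod_lt i hf
        omega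
    · simp only
      rw [← mul_nsmul', ← add_nsmul, mul_comm, Nat.add_sub_cancel']
      exact (Nat.mul_le_mul_left f (min_le_right _ _)).trans (Nat.mul_div_le i f)
  · rintro ⟨_, ⟨a, ha, rfl⟩, _, ⟨b, hb, rfl⟩, rfl⟩
    refine ⟨a * f + b, ?_, ?_⟩
    · have h1 : a * f ≤ f * w := by rw [mul_comm]; exact Nat.mul_le_mul_left f ha
      have h2 : f * w ≤ v := by
        rcases Nat.eq_zero_or_pos f with rfl | hf
        · simp
        · omega
      omega
    · simp only
      rw [add_nsmul, mul_nsmul']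

variable [Finite G]

/-- If two cyclic subgroups of `K` have coprime indices in `K`, then `K` is cyclic. -/
lemma exists_addOrderOf_eq_card {K : AddSubgroup G} {g h : G} {a b : ℕ} (hg : g ∈ K) (hh : h ∈ K)
    (ha : addOrderOf g * a = Nat.card K) (hb : addOrderOf h * b = Nat.card K)
    (hab : a.Coprime b) : ∃ x ∈ K, addOrderOf x = Nat.card K := by
  obtain ⟨x, hx⟩ := AddMonoid.exists_addOrderOf_eq_exponent
    (AddMonoid.ExponentExists.of_finite (G := K))
  have h1 : addOrderOf g ∣ AddMonoid.exponent K := by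
    have := AddMonoid.addOrder_dvd_exponent (⟨g, hg⟩ : K)
    rwa [AddSubgroup.addOrderOf_mk] at this
  have h2 : addOrderOf h ∣ AddMonoid.exponent K := by
    have := AddMonoid.addOrder_dvd_exponent (⟨h, hh⟩ : K)
    rwa [AddSubgroup.addOrderOf_mk] at this
  refine ⟨x, x.2, ?_⟩
  rw [AddSubgroup.addOrderOf_coe, hx]
  refine Nat.dvd_antisymm AddGroup.exponent_dvd_nat_card ?_
  have h3 : Nat.card K ∣ AddMonoid.exponent K * a := ha ▸ Nat.mul_dvd_mul_right h1 a
  have h4 : Nat.card K ∣ AddMonoid.exponent K * b := hb ▸ Nat.mul_dvd_mul_right h2 b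
  have := Nat.dvd_gcd h3 h4
  rwa [Nat.gcd_mul_left, hab.gcd_eq_one, mul_one] at this

lemma count_lt_addOrderOf [DecidableEq G] {U : Multiset G} (h0 : (0 : G) ∉ U)
    (hU : AddAction.stabilizer G (subsums U) = ⊥) {g : G} (hg : g ∈ U) :
    U.count g + 1 ≤ addOrderOf g := by
  by_contra! hlt
  have h1 := subsums_replicate_eq_zmultiples (n := U.count g) (g := g) hlt.le
  have h2 := stabilizer_subsums_mono (Multiset.le_count_iff_replicate_le.1 (le_refl (U.count g)))
  rw [h1, hU] at h2
  have h3 : g ∈ AddAction.stabilizer G (AddSubgroup.zmultiples g : Set G) := by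
    rw [AddAction.mem_stabilizer_set]
    intro b
    exact (AddSubgroup.zmultiples g).add_mem_cancel_left (AddSubgroup.mem_zmultiples g)
  have h4 := h2 h3
  rw [AddSubgroup.mem_bot] at h4
  exact h0 (h4 ▸ hg)

/-- Modulo `⟨g⟩`, few terms of `U` different from `g` already have many subsequence sums, as long
as the terms of `U` are repeated often. -/
lemma exists_le_filter_ncard_subsums_map [DecidableEq G] (U : Multiset G) (g : G) (m : ℕ)
    (hm : ∀ u ∈ U, m ≤ U.count u) (n : ℕ) (hn : n ≤ m)
    (hd : n + 1 ≤ Nat.card ((AddSubgroup.closure {x | x ∈ U}).map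
      (QuotientAddGroup.mk' (AddSubgroup.zmultiples g)))) :
    ∃ B ≤ U.filter (· ≠ g), B.card ≤ n ∧
      n + 1 ≤ (QuotientAddGroup.mk' (AddSubgroup.zmultiples g) '' subsums B).ncard := by
  induction n with
  | zero => exact ⟨0, Multiset.zero_le _, by simp [← Set.singleton_zero]⟩
  | succ n ih =>
    obtain ⟨B, hB, hBn, hBs⟩ := ih (by omega) (by omega)
    by_cases hlt : n + 2 ≤ (QuotientAddGroup.mk' (AddSubgroup.zmultiples g) '' subsums B).ncard
    · exact ⟨B, hB, by omega, hlt⟩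
    by_contra! hcon
    set φ := QuotientAddGroup.mk' (AddSubgroup.zmultiples g) with hφ
    have hstab : ∀ u ∈ U, φ u ∈ AddAction.stabilizer _ (subsums (B.map φ)) := by
      intro u hu
      by_cases hug : u = g
      · have : φ u = 0 := by
          rw [hug]; exact (QuotientAddGroup.eq_zero_iff g).2 (AddSubgroup.mem_zmultiples g)
        rw [this]; exact zero_mem _
      apply mem_stabilizer_subsums_of_ncard_cons_le
      have hle : u ::ₘ B ≤ U.filter (· ≠ g) := by
        rw [Multiset.le_iff_count]
        intro v
        rw [Multiset.count_cons]
        split_ifs with hvu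
        · subst hvu
          rw [Multiset.count_filter_of_pos (p := (· ≠ g)) hug]
          have := hm v hu
          have := Multiset.count_le_card v B
          omega
        · exact Multiset.le_iff_count.1 hB v
      have := hcon _ hle (by rw [Multiset.card_cons]; omega)
      rw [← Multiset.map_cons, subsums_map, subsums_map]
      omega
    have hK : (AddSubgroup.closure {x | x ∈ U}).map φ ≤
        AddAction.stabilizer _ (subsums (B.map φ)) := by
      rw [AddSubgroup.map_le_iff_le_comap, AddSubgroup.closure_le]
      exact hstab
    have h1 := Set.ncard_le_ncard
      ((SetLike.coe_subset_coe.2 hK).trans (stabilizer_le_subsums _)) (Set.toFinite _)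
    rw [ncard_coe_addSubgroup, subsums_map] at h1
    omega

/-- If the terms of `U` are repeated often and generate `K`, then `⟨g⟩` has small index in `K`
for each term `g`: otherwise `g ^ (4p-2)` together with few terms outside `⟨g⟩` would have too
many subsequence sums. -/
lemma card_map_mk'_lt [DecidableEq G] {p : ℕ} (hp : 0 < p) {U : Multiset G} (h0 : (0 : G) ∉ U)
    (hU : AddAction.stabilizer G (subsums U) = ⊥) (hm : ∀ u ∈ U, 4 * p - 1 ≤ U.count u)
    (hT : ∀ T ≤ U, T ≠ 0 → (subsums T).ncard ≤ 2 * p * T.card) {g : G} (hg : g ∈ U) :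
    Nat.card ((AddSubgroup.closure {x | x ∈ U}).map
      (QuotientAddGroup.mk' (AddSubgroup.zmultiples g))) < 4 * p := by
  by_contra! hlt
  obtain ⟨B, hB, hBc, hBs⟩ := exists_le_filter_ncard_subsums_map U g (4 * p - 1) hm (4 * p - 1)
    le_rfl (by omega)
  have hle : Multiset.replicate (4 * p - 2) g + B ≤ U := by
    have e := Multiset.filter_add_not (fun x => x = g) U
    rw [Multiset.filter_eq'] at e
    refine (add_le_add ?_ hB).trans e.le
    rw [Multiset.replicate_le_replicate]
    have := hm g hg
    omega
  have h1 := hT _ hle (by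
    intro h
    have := congrArg Multiset.card h
    simp at this
    omega)
  have h2 := count_lt_addOrderOf h0 hU hg
  have h3 := hm g hg
  have h4 := ncard_mul_ncard_image_mk_le (AddSubgroup.zmultiples g)
    (subsums (Multiset.replicate (4 * p - 2) g)) (subsums B)
    (subsums_subset_of_forall_mem _ fun x hx => by
      rw [Multiset.eq_of_mem_replicate hx]; exact AddSubgroup.mem_zmultiples g)
  rw [← subsums_add, ncard_subsums_replicate (by omega)] at h4
  rw [Multiset.card_add, Multiset.card_replicate] at h1
  -- The gain `(4p - 1) * 4p - 1` of this subsequence is at least `2p * (8p - 3)`.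
  obtain ⟨q, rfl⟩ : ∃ q, p = q + 1 := ⟨p - 1, by omega⟩
  have e1 : 4 * (q + 1) - 2 + 1 = 4 * q + 3 := by omega
  have e2 : 4 * (q + 1) - 1 + 1 = 4 * q + 4 := by omega
  rw [e1] at h4
  rw [e2] at hBs
  have e3 : 4 * (q + 1) - 2 + B.card ≤ 8 * q + 5 := by omega
  have h5 : (4 * q + 3) * (4 * q + 4) ≤ 2 * (q + 1) * (8 * q + 5) :=
    (Nat.mul_le_mul_left _ hBs).trans (h4.trans (h1.trans (Nat.mul_le_mul_left _ e3)))
  nlinarith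

/-- Numbers below `4p` that divide an integer with smallest prime factor `p` and are pairwise not
coprime all divide the largest of them. -/
lemma dvd_of_not_coprime {n p d N : ℕ} (hp3 : 3 ≤ p) (hp : ∀ q : ℕ, q.Prime → q ∣ n → p ≤ q)
    (hd : d ∣ n) (hn : n ≠ 0) (hdN : d ≤ N) (hN4 : N < 4 * p)
    (hc : ¬ d.Coprime N) : d ∣ N := by
  have hbig : ∀ c : ℕ, c ∣ n → c ≠ 1 → p ≤ c := fun c hcn hc1 =>
    (hp _ (Nat.minFac_prime hc1) ((Nat.minFac_dvd c).trans hcn)).trans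
      (Nat.minFac_le (Nat.pos_of_dvd_of_pos hcn (Nat.pos_of_ne_zero hn)))
  by_contra hdvd
  set c := Nat.gcd d N with hcdef
  obtain ⟨u, hu⟩ : c ∣ d := Nat.gcd_dvd_left _ _
  obtain ⟨w, hw⟩ : c ∣ N := Nat.gcd_dvd_right _ _
  have hc1 : p ≤ c := hbig c ((Nat.gcd_dvd_left _ _).trans hd) hc
  have hu1 : u ≠ 1 := by
    rintro rfl
    exact hdvd (by rw [hu, mul_one]; exact Nat.gcd_dvd_right _ _)
  have hup : p ≤ u := hbig u ((Dvd.intro_left c hu.symm).trans hd) hu1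
  have huw : u < w := by
    have hne : d ≠ N := fun h => hdvd (h ▸ dvd_rfl)
    have : c * u < c * w := by rw [← hu, ← hw]; omega
    exact lt_of_mul_lt_mul_left this (Nat.zero_le _)
  have : p * (p + 1) ≤ c * w := Nat.mul_le_mul hc1 (by omega)
  rw [← hw] at this
  nlinarith

/-- If some multiple `N • u` of each term lies in a subgroup common to all `⟨u⟩`, then blocks of
at most `N` equal terms have their sums in that subgroup; too many blocks would make
`subsums U` periodic. -/
lemma card_le_of_nsmul_mem [DecidableEq G] {N e : ℕ} {U : Multiset G}
    (hU : AddAction.stabilizer G (subsums U) = ⊥) (hN : 0 < N)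
    (hord : ∀ u ∈ U, N < addOrderOf u) (he : ∀ x : G, addOrderOf x ≤ e)
    (hmem : ∀ u ∈ U, ∀ v ∈ U, N • u ∈ AddSubgroup.zmultiples v) :
    U.card ≤ e + 2 * (N - 1) * U.toFinset.card := by
  -- `f u` is the smallest block length: `f u • u` is the first positive multiple of `u` in `C`.
  let C : AddSubgroup G := ⨅ v ∈ U, AddSubgroup.zmultiples v
  have hNC : ∀ u ∈ U, N • u ∈ C := fun u hu => by
    simp only [C, AddSubgroup.mem_iInf]
    exact fun v hv => hmem u hu v hv
  have hCle : ∀ u ∈ U, C ≤ AddSubgroup.zmultiples u := fun u hu => iInf₂_le u hu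
  let f : G → ℕ := fun u => addOrderOf (QuotientAddGroup.mk' C u)
  have hf0 : ∀ u, 0 < f u := fun u => addOrderOf_pos _
  have hfN : ∀ u ∈ U, f u ≤ N := fun u hu => by
    refine Nat.le_of_dvd hN ?_
    rw [addOrderOf_dvd_iff_nsmul_eq_zero, ← map_nsmul]
    exact (QuotientAddGroup.eq_zero_iff _).2 (hNC u hu)
  have hfC : ∀ u, f u • u ∈ C := fun u => by
    rw [← QuotientAddGroup.eq_zero_iff]
    have := addOrderOf_nsmul_eq_zero (QuotientAddGroup.mk' C u)
    rwa [← map_nsmul] at this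
  have hcard : ∀ u ∈ U, Nat.card C * f u = addOrderOf u := fun u hu => by
    have := card_mul_card_map_mk' (hCle u hu)
    rwa [AddMonoidHom.map_zmultiples, Nat.card_zmultiples, Nat.card_zmultiples] at this
  -- `w u` blocks are formed from the copies of `u`; at least `f u - 1` copies are kept outside the
  -- blocks, so that the multiples `0, …, count u` of `u` are still all represented.
  let w : G → ℕ := fun u => (U.count u + 1 - f u) / f u
  let W : Multiset G := ∑ u ∈ U.toFinset, Multiset.replicate (w u) (f u • u)
  let V : Multiset G := ∑ u ∈ U.toFinset, Multiset.replicate (U.count u - f u * w u) u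
  have hWV : subsums U = subsums W + subsums V := by
    have h1 : U = ∑ u ∈ U.toFinset, Multiset.replicate (U.count u) u := by
      conv_lhs => rw [← Multiset.toFinset_sum_count_nsmul_eq U]
      simp [Multiset.nsmul_singleton]
    have h2 : ∀ F : G → Multiset G,
        subsums (∑ u ∈ U.toFinset, F u) = ∑ u ∈ U.toFinset, subsums (F u) :=
      fun F => map_sum (subsumsHom G) F U.toFinset
    conv_lhs => rw [h1]
    simp only [W, V]
    rw [h2, h2, h2, ← Finset.sum_add_distrib]
    refine Finset.sum_congr rfl fun u hu => ?_
    have hcu : 0 < U.count u := Multiset.count_pos.2 (Multiset.mem_toFinset.1 hu)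
    rcases Nat.lt_or_ge (U.count u + 1) (f u) with hlt | hge
    · have : w u = 0 := by simp only [w]; rw [Nat.sub_eq_zero_of_le hlt.le, Nat.zero_div]
      simp [this]
    · refine subsums_replicate_eq_add u ?_
      have := Nat.mul_div_le (U.count u + 1 - f u) (f u)
      simp only [w]; omega
  have hW : AddAction.stabilizer G (subsums W) = ⊥ :=
    le_bot_iff.1 (hU ▸ stabilizer_subsums_le_of_eq_add _ hWV)
  have hWmem : ∀ x ∈ W, ∃ u ∈ U, x = f u • u := by
    intro x hx
    obtain ⟨u, hu, hx⟩ := Multiset.mem_sum.1 hx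
    exact ⟨u, Multiset.mem_toFinset.1 hu, Multiset.eq_of_mem_replicate hx⟩
  have hW0 : (0 : G) ∉ W := by
    intro h
    obtain ⟨u, hu, h⟩ := hWmem 0 h
    have h1 := addOrderOf_le_of_nsmul_eq_zero (hf0 u) h.symm
    have := hfN u hu
    have := hord u hu
    omega
  have hWcard : W.card = ∑ u ∈ U.toFinset, w u := by
    simp [W]
  have hWC : W.card ≤ Nat.card C := by
    have h1 := card_add_one_le_ncard_subsums_of_stabilizer_eq_bot hW0 hW
    have h2 : subsums W ⊆ C := subsums_subset_of_forall_mem C fun x hx => by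
      obtain ⟨u, -, rfl⟩ := hWmem x hx
      exact hfC u
    have h3 := Set.ncard_le_ncard h2 (Set.toFinite _)
    rw [ncard_coe_addSubgroup] at h3
    omega
  have hsum : ∑ u ∈ U.toFinset, f u * w u ≤ e := by
    have hCpos : 0 < Nat.card C := Nat.card_pos
    refine le_of_mul_le_mul_left ?_ hCpos
    rw [Finset.mul_sum]
    calc ∑ u ∈ U.toFinset, Nat.card C * (f u * w u) ≤ ∑ u ∈ U.toFinset, e * w u := by
          refine Finset.sum_le_sum fun u hu => ?_
          rw [← mul_assoc, hcard u (Multiset.mem_toFinset.1 hu)]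
          exact Nat.mul_le_mul_right _ (he u)
      _ = e * W.card := by rw [hWcard, Finset.mul_sum]
      _ ≤ Nat.card C * e := by rw [mul_comm]; exact Nat.mul_le_mul_right _ hWC
  calc U.card = ∑ u ∈ U.toFinset, U.count u := (Multiset.toFinset_sum_count_eq U).symm
    _ ≤ ∑ u ∈ U.toFinset, (f u * w u + 2 * (N - 1)) := by
        refine Finset.sum_le_sum fun u hu => ?_
        have h1 := Nat.div_add_mod (U.count u + 1 - f u) (f u)
        have h2 := Nat.mod_lt (U.count u + 1 - f u) (hf0 u)
        have h3 := hfN u (Multiset.mem_toFinset.1 hu)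
        have h4 := hf0 u
        simp only [w]; omega
    _ = (∑ u ∈ U.toFinset, f u * w u) + 2 * (N - 1) * U.toFinset.card := by
        rw [Finset.sum_add_distrib, Finset.sum_const, smul_eq_mul, mul_comm (U.toFinset.card)]
    _ ≤ _ := Nat.add_le_add_right hsum _

/-- A sequence of terms of high multiplicity without a subsequence of large gain is, up to a
bounded number of terms, no longer than the largest order of an element. -/
lemma card_le_of_forall_le_count [DecidableEq G] {p e : ℕ} (hp3 : 3 ≤ p)
    (hp : ∀ q : ℕ, q.Prime → q ∣ Nat.card G → p ≤ q) {U : Multiset G} (h0 : (0 : G) ∉ U)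
    (hU : AddAction.stabilizer G (subsums U) = ⊥) (he : ∀ x : G, addOrderOf x ≤ e)
    (hm : ∀ u ∈ U, 4 * p - 1 ≤ U.count u)
    (hT : ∀ T ≤ U, T ≠ 0 → (subsums T).ncard ≤ 2 * p * T.card) :
    U.card ≤ e + (8 * p - 4) * U.toFinset.card := by
  rcases U.empty_or_exists_mem with rfl | hne
  · simp
  set K := AddSubgroup.closure {x | x ∈ U} with hK
  have hUK : ∀ u ∈ U, u ∈ K := fun u hu => AddSubgroup.subset_closure hu
  have hzK : ∀ u ∈ U, AddSubgroup.zmultiples u ≤ K := fun u hu =>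
    AddSubgroup.zmultiples_le_of_mem (hUK u hu)
  let d : G → ℕ := fun u => Nat.card (K.map (QuotientAddGroup.mk' (AddSubgroup.zmultiples u)))
  have hd4 : ∀ u ∈ U, d u < 4 * p := fun u hu => card_map_mk'_lt (by omega) h0 hU hm hT hu
  have hdK : ∀ u ∈ U, addOrderOf u * d u = Nat.card K := fun u hu => by
    have := card_mul_card_map_mk' (hzK u hu)
    rwa [Nat.card_zmultiples] at this
  -- Either `K` is cyclic, and then `|U| < |K| ≤ e`, or all indices `d u` divide the largest one,
  -- `N < 4p`, and then `N • K` is contained in every `⟨u⟩`.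
  by_cases hcop : ∃ u ∈ U, ∃ v ∈ U, (d u).Coprime (d v)
  · obtain ⟨u, hu, v, hv, huv⟩ := hcop
    obtain ⟨x, -, hx⟩ := exists_addOrderOf_eq_card (hUK u hu) (hUK v hv) (hdK u hu) (hdK v hv) huv
    have h1 := card_add_one_le_ncard_subsums_of_stabilizer_eq_bot h0 hU
    have h2 := Set.ncard_le_ncard (subsums_subset_of_forall_mem K hUK) (Set.toFinite _)
    rw [ncard_coe_addSubgroup, ← hx] at h2
    have := he x
    omega
  · push Not at hcop
    obtain ⟨x₀, hx₀⟩ := hne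
    obtain ⟨v, hv, hmax⟩ := Finset.exists_max_image U.toFinset d ⟨x₀, Multiset.mem_toFinset.2 hx₀⟩
    rw [Multiset.mem_toFinset] at hv
    have hdvd : ∀ u ∈ U, d u ∣ d v := fun u hu =>
      dvd_of_not_coprime hp3 hp
        ((Dvd.intro_left _ (hdK u hu)).trans (AddSubgroup.card_addSubgroup_dvd_card K))
        Nat.card_pos.ne' (hmax u (Multiset.mem_toFinset.2 hu)) (hd4 v hv) (hcop u hu v hv)
    have h1 := card_le_of_nsmul_mem (N := d v) hU Nat.card_pos (fun u hu => by
        have h1 := hd4 v hv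
        have h2 := hm u hu
        have h3 := count_lt_addOrderOf h0 hU hu
        omega) he (fun u hu x hx => by
        obtain ⟨k, hk⟩ := hdvd x hx
        rw [hk, mul_comm, mul_nsmul']
        exact nsmul_mem (card_map_mk'_nsmul_mem _ K (hUK u hu)) k)
    refine h1.trans (Nat.add_le_add_left (Nat.mul_le_mul_right _ ?_) _)
    have := hd4 v hv
    omega

end HighMultiplicity

/-! ### Sequences with aperiodic set of subsequence sums -/

section Aperiodic

lemma sq_mul_three_pow_le (k : ℕ) : k ^ 2 * 3 ^ k ≤ 7 * 4 ^ k := by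
  rcases Nat.lt_or_ge k 7 with h | h
  · interval_cases k <;> norm_num
  · induction k, h using Nat.le_induction with
    | base => norm_num
    | succ k hk ih =>
      have h1 : 3 * (k + 1) ^ 2 ≤ 4 * k ^ 2 := by nlinarith
      calc (k + 1) ^ 2 * 3 ^ (k + 1) = 3 * (k + 1) ^ 2 * 3 ^ k := by ring
        _ ≤ 4 * k ^ 2 * 3 ^ k := Nat.mul_le_mul_right _ h1
        _ = 4 * (k ^ 2 * 3 ^ k) := by ring
        _ ≤ 4 * (7 * 4 ^ k) := Nat.mul_le_mul_left _ ih
        _ = 7 * 4 ^ (k + 1) := by ring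

/-- A size of a subset with distinct subset sums for which `2 ^ (k + 1)` is large compared with
`2 * p * (k + 1)`, while `3 ^ k` is still small compared with `p ^ 3`. -/
lemma exists_dissociated_size {p : ℕ} (hp : 3 ≤ p) :
    ∃ k : ℕ, 2 * p * (k + 1) + 1 ≤ 2 ^ (k + 1) ∧ 2 * 3 ^ k ≤ 9 * p ^ 3 := by
  rcases Nat.lt_or_ge p 7 with h7 | h7
  · interval_cases p
    · exact ⟨4, by norm_num⟩
    · exact ⟨5, by norm_num⟩
    · exact ⟨5, by norm_num⟩
    · exact ⟨6, by norm_num⟩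
  · have hex : ∃ k : ℕ, 2 * p * (k + 1) + 1 ≤ 2 ^ (k + 1) := by
      refine ⟨2 * p + 3, ?_⟩
      have h1 : 2 * p + 4 < 2 ^ (2 * p + 4) := Nat.lt_two_pow_self
      have h2 : ∀ n : ℕ, 4 ≤ n → n * n ≤ 2 ^ n := by
        intro n hn
        induction n, hn using Nat.le_induction with
        | base => norm_num
        | succ n hn ih => rw [pow_succ]; nlinarith
      have := h2 (2 * p + 3 + 1) (by omega)
      nlinarith
    classical
    refine ⟨Nat.find hex, Nat.find_spec hex, ?_⟩
    set k := Nat.find hex with hk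
    rcases Nat.eq_zero_or_pos k with h0 | hpos
    · rw [h0]; nlinarith [pow_le_pow_left₀ (Nat.zero_le 7) h7 3]
    · have h1 := Nat.find_min hex (m := k - 1) (by omega)
      rw [Nat.sub_add_cancel hpos] at h1
      have h2 : 2 ^ k ≤ 2 * p * k := by omega
      have h3 : 4 ^ k ≤ 4 * p ^ 2 * k ^ 2 := by
        calc 4 ^ k = 2 ^ k * 2 ^ k := by rw [← mul_pow]; norm_num
          _ ≤ (2 * p * k) * (2 * p * k) := Nat.mul_le_mul h2 h2
          _ = _ := by ring
      have h4 := sq_mul_three_pow_le k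
      have h5 : k ^ 2 * 3 ^ k ≤ k ^ 2 * (28 * p ^ 2) := by nlinarith
      have h6 := Nat.le_of_mul_le_mul_left h5 (by positivity)
      have h7' : 7 * p ^ 2 ≤ p ^ 3 := by rw [pow_succ p 2, mul_comm]; exact Nat.mul_le_mul_left _ h7
      nlinarith

variable {G : Type*} [AddCommGroup G] [Finite G]

/-- A sequence without a subsequence of large gain is, up to `O(p ^ 4)` terms, no longer than the
largest order of an element. -/
lemma card_le_of_forall_ncard_subsums_le {p e : ℕ} (hp3 : 3 ≤ p)
    (hp : ∀ q : ℕ, q.Prime → q ∣ Nat.card G → p ≤ q) (he : ∀ x : G, addOrderOf x ≤ e)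
    {R : Multiset G} (h0 : (0 : G) ∉ R) (hR : AddAction.stabilizer G (subsums R) = ⊥)
    (hT : ∀ T ≤ R, T ≠ 0 → (subsums T).ncard ≤ 2 * p * T.card) :
    R.card + 18 * p ^ 3 ≤ e + 36 * p ^ 4 := by
  classical
  obtain ⟨k, hk1, hk2⟩ := exists_dissociated_size hp3
  have hdist : R.toFinset.card ≤ 3 ^ k := by
    by_contra! hlt
    obtain ⟨T, hTR, hTc, hTs, -⟩ := exists_le_ncard_subsums_eq_two_pow R.toFinset (k + 1)
      (Or.inl (by rw [pow_succ]; omega))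
    have hTR' : T ≤ R := hTR.trans (by rw [Multiset.toFinset_val]; exact Multiset.dedup_le R)
    have := hT T hTR' (by rintro rfl; simp at hTc)
    rw [hTc, hTs] at this
    omega
  -- `U` collects the terms of high multiplicity, `V` the others; `V` has few distinct terms.
  set U := R.filter (fun x => 4 * p - 1 ≤ R.count x) with hU
  set V := R.filter (fun x => ¬ 4 * p - 1 ≤ R.count x) with hV
  have hUR : U ≤ R := Multiset.filter_le _ _
  have hRUV : U.card + V.card = R.card := by
    rw [← Multiset.card_add, hU, hV, Multiset.filter_add_not]
  have hfin : U.toFinset.card + V.toFinset.card = R.toFinset.card := by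
    rw [hU, hV, Multiset.toFinset_filter, Multiset.toFinset_filter,
      Finset.card_filter_add_card_filter_not]
  have h1 : U.card ≤ e + (8 * p - 4) * U.toFinset.card := by
    refine card_le_of_forall_le_count hp3 hp (fun h => h0 (Multiset.mem_of_le hUR h)) ?_ he ?_
      fun T hTU => hT T (hTU.trans hUR)
    · exact le_bot_iff.1 (hR ▸ stabilizer_subsums_mono hUR)
    · intro u hu
      have := (Multiset.mem_filter.1 hu).2
      rwa [hU, Multiset.count_filter, if_pos this]
  have h2 : V.card ≤ (8 * p - 4) * V.toFinset.card := by
    rw [← Multiset.toFinset_sum_count_eq V, mul_comm]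
    refine Finset.sum_le_card_nsmul _ _ _ fun u hu => ?_
    have h := (Multiset.mem_filter.1 (Multiset.mem_toFinset.1 hu)).2
    rw [hV, Multiset.count_filter, if_pos h]
    omega
  have h3 : (8 * p - 4) * U.toFinset.card + (8 * p - 4) * V.toFinset.card ≤ (8 * p - 4) * 3 ^ k := by
    rw [← mul_add, hfin]; exact Nat.mul_le_mul_left _ hdist
  have h4 : (8 * p - 4) * (2 * 3 ^ k) ≤ (8 * p - 4) * (9 * p ^ 3) := Nat.mul_le_mul_left _ hk2
  have h5 : (8 * p - 4) * (9 * p ^ 3) + 36 * p ^ 3 = 72 * p ^ 4 := by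
    obtain ⟨q, rfl⟩ : ∃ q, p = q + 1 := ⟨p - 1, by omega⟩
    have : 8 * (q + 1) - 4 = 8 * q + 4 := by omega
    rw [this]; ring
  have h6 : (8 * p - 4) * (2 * 3 ^ k) = 2 * ((8 * p - 4) * 3 ^ k) := by ring
  omega

/-- The subsequence sums of a sequence of length at least `|G| / p` are periodic. Subsequences
whose average gain is at least `2p` are split off as long as possible; by Kneser's theorem their
gains add up, and what remains is short. -/
theorem mul_card_lt_of_stabilizer_eq_bot {p e : ℕ} (hp3 : 3 ≤ p)
    (hp : ∀ q : ℕ, q.Prime → q ∣ Nat.card G → p ≤ q) (he : ∀ x : G, addOrderOf x ≤ e)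
    (heG : e * (2 * p + 1) ≤ Nat.card G) (hcard : 72 * p ^ 6 ≤ Nat.card G)
    {S : Multiset G} (h0 : (0 : G) ∉ S) (hS : AddAction.stabilizer G (subsums S) = ⊥) :
    p * S.card < Nat.card G := by
  classical
  obtain ⟨Q, hQ, hmax⟩ := Finset.exists_max_image
    (S.powerset.toFinset.filter fun Q => 2 * p * Q.card + 1 ≤ (subsums Q).ncard) Multiset.card
    ⟨0, by simp [← Set.singleton_zero]⟩
  simp only [Finset.mem_filter, Multiset.mem_toFinset, Multiset.mem_powerset] at hQ hmax
  obtain ⟨R, hSQR⟩ := Multiset.le_iff_exists_add.1 hQ.1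
  have hap : ∀ T ≤ S, AddAction.stabilizer G (subsums T) = ⊥ := fun T hT =>
    le_bot_iff.1 (hS ▸ stabilizer_subsums_mono hT)
  have hRS : R ≤ S := hSQR ▸ Multiset.le_add_left _ _
  have hR0 : (0 : G) ∉ R := fun h => h0 (Multiset.mem_of_le hRS h)
  have hRcard := card_le_of_forall_ncard_subsums_le hp3 hp he hR0 (hap R hRS) (by
    intro T hTR hT0
    by_contra! hlt
    have hle : Q + T ≤ S := hSQR ▸ add_le_add_right hTR Q
    have h1 := ncard_subsums_add_ncard_subsums_le (hap _ hle)
    have h2 := hmax (Q + T) ⟨hle, by rw [Multiset.card_add, mul_add]; omega⟩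
    rw [Multiset.card_add] at h2
    exact hT0 (Multiset.card_eq_zero.1 (by omega)))
  have h1 := ncard_subsums_add_ncard_subsums_le (S := Q) (T := R) (hSQR ▸ hS)
  rw [← hSQR] at h1
  have h2 := card_add_one_le_ncard_subsums_of_stabilizer_eq_bot hR0 (hap R hRS)
  have h3 : (subsums S).ncard ≤ Nat.card G := Set.ncard_le_card _
  have h4 : S.card = Q.card + R.card := by rw [hSQR, Multiset.card_add]
  obtain ⟨q, rfl⟩ : ∃ q, p = q + 1 := ⟨p - 1, by omega⟩
  -- All gains together stay below `|G|`, so `2p |S| ≤ |G| + (2p - 1) |R|`; the bounds on `R` and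
  -- `e` then contradict `2 |G| ≤ 2p |S|`.
  have h5 : 2 * (q + 1) * S.card ≤ Nat.card G + (2 * q + 1) * R.card := by
    rw [h4]; nlinarith
  have h6 : (2 * q + 1) * ((2 * q + 3) * (R.card + 18 * (q + 1) ^ 3)) ≤
      (2 * q + 1) * ((2 * q + 3) * (e + 36 * (q + 1) ^ 4)) :=
    Nat.mul_le_mul_left _ (Nat.mul_le_mul_left _ hRcard)
  by_contra! hge
  have h7 : (2 * q + 3) * Nat.card G ≤ (2 * q + 3) * ((2 * q + 1) * R.card) :=
    Nat.mul_le_mul_left _ (by nlinarith)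
  have h8 : (2 * q + 1) * (e * (2 * (q + 1) + 1)) ≤ (2 * q + 1) * Nat.card G :=
    Nat.mul_le_mul_left _ heG
  have h9 : (2 * q + 1) * ((2 * q + 3) * (36 * (q + 1) ^ 4)) + 36 * (q + 1) ^ 4 =
      144 * (q + 1) ^ 6 := by ring
  have h10 : 0 < (2 * q + 1) * ((2 * q + 3) * (18 * (q + 1) ^ 3)) := by positivity
  nlinarith

end Aperiodic

/-! ### Zero-sum free sequences -/

lemma exists_le_map_eq_of_le_map {α β : Type*} {f : α → β} {S : Multiset α} {V : Multiset β}
    (h : V ≤ S.map f) : ∃ U ≤ S, U.map f = V := by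
  induction S using Multiset.induction_on generalizing V with
  | empty => exact ⟨0, le_rfl, by simpa [eq_comm] using h⟩
  | cons a S ih =>
    rw [Multiset.map_cons] at h
    by_cases ha : f a ∈ V
    · obtain ⟨V', rfl⟩ := Multiset.exists_cons_of_mem ha
      obtain ⟨U, hU, rfl⟩ := ih ((Multiset.cons_le_cons_iff _).1 h)
      exact ⟨a ::ₘ U, Multiset.cons_le_cons a hU, Multiset.map_cons _ _ _⟩
    · obtain ⟨U, hU, rfl⟩ := ih ((Multiset.le_cons_of_notMem ha).1 h)
      exact ⟨U, hU.trans (Multiset.le_cons_self _ _), rfl⟩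

section ZeroSumFree

variable {G : Type*} [AddCommGroup G]

/-- `S` is zero-sum free: no nonempty subsequence of `S` has sum zero. -/
def IsZeroSumFree (S : Multiset G) : Prop := ∀ U ≤ S, U ≠ 0 → U.sum ≠ 0

lemma IsZeroSumFree.mono {S T : Multiset G} (hT : IsZeroSumFree T) (h : S ≤ T) :
    IsZeroSumFree S := fun U hU => hT U (hU.trans h)

lemma IsZeroSumFree.neg_notMem {a : G} {S : Multiset G} (h : IsZeroSumFree (a ::ₘ S)) :
    -a ∉ subsums S := by
  rintro ⟨U, hU, hs⟩
  exact h (a ::ₘ U) (Multiset.cons_le_cons a hU) (Multiset.cons_ne_zero) (by simp [hs])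

variable [Finite G]

lemma IsZeroSumFree.card_add_ncard_subsums_le {R S : Multiset G} (h : IsZeroSumFree (R + S)) :
    R.card + (subsums S).ncard ≤ (subsums (R + S)).ncard := by
  induction R using Multiset.induction_on with
  | empty => simp
  | cons a R ih =>
    rw [Multiset.cons_add] at h ⊢
    have h1 := ih (h.mono (Multiset.le_cons_self _ _))
    have h2 : ¬ (subsums (a ::ₘ (R + S))).ncard ≤ (subsums (R + S)).ncard := fun h' =>
      h.neg_notMem (stabilizer_le_subsums _
        (neg_mem (mem_stabilizer_subsums_of_ncard_cons_le h')))
    rw [Multiset.card_cons]; omega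

/-- A zero-sum free sequence of the maximal length `|K| - 1` over `K` has all its terms equal, so
that `K` is cyclic. -/
lemma IsZeroSumFree.exists_card_le_addOrderOf {S : Multiset G} (h : IsZeroSumFree S)
    (K : AddSubgroup G) (hK : ∀ x ∈ S, x ∈ K) (hK1 : 1 < Nat.card K)
    (hcard : Nat.card K ≤ S.card + 1) :
    subsums S = K ∧ ∃ x ∈ S, Nat.card K ≤ addOrderOf x := by
  classical
  have hsub := subsums_subset_of_forall_mem K hK
  have hle := Set.ncard_le_ncard hsub (Set.toFinite _)
  rw [ncard_coe_addSubgroup] at hle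
  have h1 := IsZeroSumFree.card_add_ncard_subsums_le (R := S) (S := 0) (by simpa using h)
  have h1' : S.card + 1 ≤ (subsums S).ncard := by
    simpa [← Set.singleton_zero] using h1
  refine ⟨Set.eq_of_subset_of_ncard_le hsub (by rw [ncard_coe_addSubgroup]; omega), ?_⟩
  obtain ⟨x, hx⟩ := Multiset.exists_mem_of_ne_zero (s := S) (by
    rintro rfl; simp at hcard; omega)
  refine ⟨x, hx, ?_⟩
  have hall : ∀ y ∈ S, y = x := by
    intro y hy
    by_contra hne
    obtain ⟨R, hR⟩ := Multiset.le_iff_exists_add.1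
      ((Multiset.le_iff_subset (s := {x, y}) (t := S) (by simpa using Ne.symm hne)).2 (by
        intro z hz
        rcases (by simpa using hz : z = x ∨ z = y) with rfl | rfl <;> assumption))
    rw [add_comm] at hR
    have h2 := IsZeroSumFree.card_add_ncard_subsums_le (R := R) (S := {x, y}) (hR ▸ h)
    rw [← hR] at h2
    have hxy : IsZeroSumFree ({x, y} : Multiset G) := h.mono (hR ▸ Multiset.le_add_left _ _)
    have hx0 : x ≠ 0 := by
      have := hxy {x} (by simp) (by simp)
      simpa using this
    have hy0 : y ≠ 0 := by
      have := hxy {y} (by simp) (by simp)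
      simpa using this
    have hxy0 : x + y ≠ 0 := by
      have := hxy {x, y} le_rfl (by simp)
      simpa using this
    have h3 : 4 ≤ (subsums ({x, y} : Multiset G)).ncard := by
      have h4 : (({0, x, y, x + y} : Finset G) : Set G) ⊆ subsums ({x, y} : Multiset G) := by
        intro z hz
        simp only [Finset.coe_insert, Finset.coe_singleton, Set.mem_insert_iff,
          Set.mem_singleton_iff] at hz
        rcases hz with rfl | rfl | rfl | rfl
        · exact zero_mem_subsums _
        · exact ⟨{z}, by simp, by simp⟩
        · exact ⟨{z}, by simp, by simp⟩
        · exact ⟨{x, y}, le_rfl, by simp⟩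
      have h5 := Set.ncard_le_ncard h4 (Set.toFinite _)
      rw [Set.ncard_coe_finset] at h5
      have h6 : ({0, x, y, x + y} : Finset G).card = 4 := by
        rw [Finset.card_insert_of_notMem, Finset.card_insert_of_notMem,
          Finset.card_insert_of_notMem, Finset.card_singleton]
        · simpa using hx0
        · simpa using ⟨Ne.symm hne, hy0⟩
        · simpa using ⟨hx0.symm, hy0.symm, hxy0.symm⟩
      omega
    have h7 : S.card = R.card + 2 := by rw [hR]; simp
    omega
  have hrep := Multiset.eq_replicate_card.2 hall
  by_contra! hlt
  refine h (Multiset.replicate (addOrderOf x) x) ?_ ?_ ?_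
  · conv_rhs => rw [hrep]
    rw [Multiset.replicate_le_replicate]; omega
  · intro h0
    have := congrArg Multiset.card h0
    rw [Multiset.card_replicate, Multiset.card_zero] at this
    have := addOrderOf_pos x
    omega
  · simp [addOrderOf_nsmul_eq_zero]

end ZeroSumFree

/-! ### Regular sequences that are long enough are additive bases -/

section Regular

variable {G : Type*} [AddCommGroup G] [Finite G]

lemma IsRegularSeq.mono {S T : Multiset G} (hT : IsRegularSeq T) (h : S ≤ T) :
    IsRegularSeq S := by
  classical
  exact fun H hH => (Multiset.card_le_card (Multiset.filter_le_filter _ h)).trans (hT H hH)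

lemma IsRegularSeq.zero_notMem [Nontrivial G] {S : Multiset G} (hS : IsRegularSeq S) :
    (0 : G) ∉ S := by
  classical
  intro h
  have := hS ⊥ bot_ne_top
  rw [AddSubgroup.card_bot, termsIn] at this
  have h1 : (0 : G) ∈ S.filter (fun g => g ∈ (⊥ : AddSubgroup G)) :=
    Multiset.mem_filter.2 ⟨h, zero_mem _⟩
  have := Multiset.card_pos_iff_exists_mem.2 ⟨_, h1⟩
  omega

open Classical in
/-- If the subsequence sums of a long sequence do not exhaust `G`, their stabilizer is a proper
nontrivial subgroup, and only few terms lie outside it. -/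
lemma exists_card_filter_add_two_le_index {p e : ℕ} (hp3 : 3 ≤ p)
    (hp : ∀ q : ℕ, q.Prime → q ∣ Nat.card G → p ≤ q) (he : ∀ x : G, addOrderOf x ≤ e)
    (heG : e * (2 * p + 1) ≤ Nat.card G) (hcard : 72 * p ^ 6 ≤ Nat.card G)
    {S : Multiset G} (h0 : (0 : G) ∉ S) (hlen : Nat.card G ≤ p * S.card)
    (hS : subsums S ≠ Set.univ) :
    ∃ H : AddSubgroup G, H ≠ ⊥ ∧ H ≠ ⊤ ∧ (S.filter (· ∉ H)).card + 2 ≤ H.index := by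
  have hbot : AddAction.stabilizer G (subsums S) ≠ ⊥ := fun h => by
    have := mul_card_lt_of_stabilizer_eq_bot hp3 hp he heG hcard h0 h
    omega
  have htop : AddAction.stabilizer G (subsums S) ≠ ⊤ := fun h => by
    have := stabilizer_le_subsums S
    rw [h] at this
    exact hS (Set.univ_subset_iff.1 this)
  refine ⟨_, hbot, htop, ?_⟩
  have h1 := card_stabilizer_mul_le_ncard_subsums S
  have h2 := ncard_eq_card_mul_ncard_image_mk (AddAction.stabilizer G (subsums S)) (subsums S) le_rfl
  rw [h2] at h1
  have h3 := Nat.le_of_mul_le_mul_left h1 Nat.card_pos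
  have h4 : (QuotientAddGroup.mk '' subsums S : Set (G ⧸ AddAction.stabilizer G (subsums S))).ncard <
      (AddAction.stabilizer G (subsums S)).index := by
    by_contra! hge
    refine hS (Set.eq_of_subset_of_ncard_le (Set.subset_univ _) ?_)
    rw [Set.ncard_univ, h2, ← (AddAction.stabilizer G (subsums S)).card_mul_index]
    exact Nat.mul_le_mul_left _ hge
  convert Nat.succ_le_of_lt (h3.trans_lt h4)

/-- A proper nontrivial subgroup satisfies `|H| + |G : H| ≤ |G| / p + p`. -/
lemma card_add_index_le {p : ℕ} (hp : ∀ q : ℕ, q.Prime → q ∣ Nat.card G → p ≤ q) {n : ℕ}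
    (hn : n * p = Nat.card G) {H : AddSubgroup G} (hbot : H ≠ ⊥) (htop : H ≠ ⊤) :
    Nat.card H + H.index ≤ n + p := by
  have hbig : ∀ c : ℕ, c ∣ Nat.card G → c ≠ 1 → p ≤ c := fun c hcn hc1 =>
    (hp _ (Nat.minFac_prime hc1) ((Nat.minFac_dvd c).trans hcn)).trans
      (Nat.minFac_le (Nat.pos_of_dvd_of_pos hcn Nat.card_pos))
  have h1 := hbig _ H.card_addSubgroup_dvd_card (by rwa [Ne, AddSubgroup.card_eq_one])
  have h2 := hbig _ H.index_dvd_card (by rwa [Ne, AddSubgroup.index_eq_one])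
  have h3 := H.card_mul_index
  rw [← hn] at h3
  have hp0 : 0 < p := by
    rcases Nat.eq_zero_or_pos p with rfl | h
    · have : 0 < Nat.card G := Nat.card_pos
      omega
    · exact h
  obtain ⟨a, ha⟩ := Nat.exists_eq_add_of_le h1
  obtain ⟨b, hb⟩ := Nat.exists_eq_add_of_le h2
  rw [ha, hb] at h3 ⊢
  refine Nat.le_of_mul_le_mul_left ?_ hp0
  nlinarith [Nat.zero_le (a * b)]

/-- Regularity rules out a proper nontrivial stabilizer `H`, because it bounds the number of terms
inside `H` while Kneser-type growth bounds the number outside. -/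
theorem isAdditiveBasis_of_isRegularSeq {p e n : ℕ} (hp3 : 3 ≤ p)
    (hp : ∀ q : ℕ, q.Prime → q ∣ Nat.card G → p ≤ q) (he : ∀ x : G, addOrderOf x ≤ e)
    (heG : e * (2 * p + 1) ≤ Nat.card G) (hcard : 72 * p ^ 6 ≤ Nat.card G)
    (hn : n * p = Nat.card G) {S : Multiset G} (hS : IsRegularSeq S) (hlen : n + p ≤ S.card + 2) :
    IsAdditiveBasis S := by
  classical
  have hG1 : 1 < Nat.card G := by
    have : 0 < p ^ 6 := by positivity
    omega
  have : Nontrivial G := Finite.one_lt_card_iff_nontrivial.1 hG1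
  have hsplit : ∀ (H : AddSubgroup G) (T : Multiset G),
      (termsIn T H).card + (T.filter (· ∉ H)).card = T.card := fun H T => by
    rw [← Multiset.card_add, termsIn]
    convert congrArg Multiset.card (Multiset.filter_add_not (· ∈ H) T)
  have huniv : subsums S = Set.univ := by
    by_contra hne
    obtain ⟨H, hbot, htop, hH⟩ := exists_card_filter_add_two_le_index hp3 hp he heG hcard
      hS.zero_notMem (by rw [← hn, mul_comm]; exact Nat.mul_le_mul_left _ (by omega)) hne
    have h1 := card_add_index_le hp hn hbot htop
    have h2 := hS H htop
    have h3 := hsplit H S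
    have h4 : 0 < Nat.card H := Nat.card_pos
    omega
  -- If `S` were zero-sum free, removing a term `s` would leave a sequence that misses `-s`. The
  -- counts are then tight: `H` and `G ⧸ H` both carry zero-sum free sequences of maximal length,
  -- so both are cyclic, and `|H| + |G : H| ≥ |G| / p + p` is too large for that.
  have hzero : ¬ IsZeroSumFree S := by
    intro hzsf
    obtain ⟨s, hs⟩ := Multiset.exists_mem_of_ne_zero (s := S) (by
      rintro rfl
      simp at hlen
      omega)
    obtain ⟨S', rfl⟩ := Multiset.exists_cons_of_mem hs
    have hle : S' ≤ s ::ₘ S' := Multiset.le_cons_self _ _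
    rw [Multiset.card_cons] at hlen
    obtain ⟨H, hbot, htop, hH⟩ := exists_card_filter_add_two_le_index hp3 hp he heG hcard
      (hS.mono hle).zero_notMem (by rw [← hn, mul_comm]; exact Nat.mul_le_mul_left _ (by omega))
      (fun h => hzsf.neg_notMem (h ▸ Set.mem_univ _))
    have h1 := card_add_index_le hp hn hbot htop
    have h2 := hS H htop
    have h3 := hsplit H (s ::ₘ S')
    have h4 : 0 < Nat.card H := Nat.card_pos
    have h5 : ((s ::ₘ S').filter (· ∉ H)).card ≤ (S'.filter (· ∉ H)).card + 1 := by
      rw [Multiset.filter_cons, Multiset.card_add]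
      split_ifs <;> simp [add_comm]
    rw [Multiset.card_cons] at h3
    set S := s ::ₘ S' with hSdef
    have hHle : termsIn S H ≤ S := Multiset.filter_le _ _
    obtain ⟨hHsum, x, -, hx⟩ := (hzsf.mono hHle).exists_card_le_addOrderOf H
      (fun x hx => (Multiset.mem_filter.1 hx).2)
      (by rw [AddSubgroup.one_lt_card_iff_ne_bot]; exact hbot) (by omega)
    have hquot : IsZeroSumFree ((S.filter (· ∉ H)).map (QuotientAddGroup.mk' H)) := by
      intro V hV hV0 hVs
      obtain ⟨U, hU, rfl⟩ : ∃ U ≤ S.filter (· ∉ H), U.map (QuotientAddGroup.mk' H) = V :=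
        exists_le_map_eq_of_le_map hV
      rw [← map_multiset_sum] at hVs
      have hUH : U.sum ∈ H := (QuotientAddGroup.eq_zero_iff _).1 hVs
      have : -U.sum ∈ subsums (termsIn S H) := by rw [hHsum]; exact neg_mem hUH
      obtain ⟨W, hW, hWs⟩ := this
      refine hzsf (W + U) ?_ ?_ (by simp [hWs])
      · have := Multiset.filter_add_not (· ∈ H) S
        refine (add_le_add hW hU).trans (le_of_eq ?_)
        rw [termsIn]; convert this
      · intro h
        exact hV0 (by rw [(add_eq_zero.1 h).2, Multiset.map_zero])
    obtain ⟨-, y, hy, hy'⟩ := hquot.exists_card_le_addOrderOf ⊤ (fun _ _ => AddSubgroup.mem_top _)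
      (by
        rw [AddSubgroup.card_top, ← AddSubgroup.index_eq_card]
        have : H.index ≠ 1 := by rwa [Ne, AddSubgroup.index_eq_one]
        have := AddSubgroup.index_ne_zero_of_finite (H := H)
        omega)
      (by
        rw [AddSubgroup.card_top, ← AddSubgroup.index_eq_card, Multiset.card_map]
        omega)
    obtain ⟨z, -, rfl⟩ := Multiset.mem_map.1 hy
    rw [AddSubgroup.card_top, ← AddSubgroup.index_eq_card] at hy'
    have h6 := Nat.le_of_dvd (addOrderOf_pos z) (addOrderOf_map_dvd (QuotientAddGroup.mk' H) z)
    have h7 := he x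
    have h8 := he z
    have h9 : n + p ≤ 2 * e := by omega
    nlinarith
  rw [IsAdditiveBasis, Set.eq_univ_iff_forall]
  intro g
  by_cases hg : g = 0
  · simp only [IsZeroSumFree, not_forall, not_not] at hzero
    obtain ⟨U, hU, hU0, hUs⟩ := hzero
    exact ⟨U, hU, hU0, hUs.trans hg.symm⟩
  · obtain ⟨U, hU, hUs⟩ : g ∈ subsums S := huniv ▸ Set.mem_univ g
    exact ⟨U, hU, by rintro rfl; exact hg (by simpa using hUs.symm), hUs⟩

end Regular

/-! ### A long regular sequence that is not an additive basis -/

/-- All nonzero elements of a subgroup of index `p` and `p - 2` elements of one further coset form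
a regular sequence that misses a coset. -/
theorem le_of_mem_basisLengths {G : Type*} [AddCommGroup G] [Finite G] {p n t : ℕ} [Fact p.Prime]
    (hn : n * p = Nat.card G) (hpn : p ≤ n + 2) (χ : G →+ ZMod p) (hχ : Function.Surjective χ)
    (ht : t ∈ basisLengths G) : n + p - 2 ≤ t := by
  classical
  by_contra! hlt
  have := Fintype.ofFinite G
  have hp2 : 2 ≤ p := (Fact.out : p.Prime).two_le
  obtain ⟨g₁, hg₁⟩ := hχ 1
  have hker : Nat.card χ.ker = n := by
    have h1 := χ.ker.card_mul_index
    rw [AddSubgroup.index_ker, AddMonoidHom.range_eq_top.2 hχ, AddSubgroup.card_top,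
      Nat.card_zmod, ← hn] at h1
    exact Nat.eq_of_mul_eq_mul_right (by omega) h1
  let A : Finset G := Finset.univ.filter fun x => χ x = 0
  have hA : A.card = n := by
    rw [← hker, Nat.card_eq_fintype_card, Fintype.card_of_subtype]
    intro x; simp [A, AddMonoidHom.mem_ker]
  obtain ⟨F, hF, hFc⟩ := Finset.exists_subset_card_eq
    (s := A.image (g₁ + ·)) (n := p - 2) (by
      rw [Finset.card_image_of_injective _ (add_right_injective g₁), hA]; omega)
  have hF1 : ∀ x ∈ F, χ x = 1 := fun x hx => by
    obtain ⟨a, ha, rfl⟩ := Finset.mem_image.1 (hF hx)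
    rw [map_add, hg₁, (Finset.mem_filter.1 ha).2, add_zero]
  have hdisj : Disjoint (A.erase 0) F := by
    rw [Finset.disjoint_left]
    intro x hx hxF
    have h1 := hF1 x hxF
    rw [(Finset.mem_filter.1 (Finset.mem_of_mem_erase hx)).2] at h1
    exact zero_ne_one h1
  set X := A.erase 0 ∪ F with hX
  have hXc : X.card = n - 1 + (p - 2) := by
    rw [Finset.card_union_of_disjoint hdisj, hFc, Finset.card_erase_of_mem (by simp [A]), hA]
  have hX0 : (0 : G) ∉ X := by
    intro h
    rcases Finset.mem_union.1 h with h | h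
    · simp at h
    · have := hF1 0 h
      rw [map_zero] at this
      exact zero_ne_one this
  have hreg : IsRegularSeq X.val := by
    intro H _
    have h1 : insert 0 (X.filter (· ∈ H)) ⊆ (H : Set G).toFinset := by
      intro x hx
      rcases Finset.mem_insert.1 hx with rfl | hx
      · simp
      · simpa using (Finset.mem_filter.1 hx).2
    have h2 := Finset.card_le_card h1
    rw [Finset.card_insert_of_notMem (fun h => hX0 (Finset.mem_filter.1 h).1),
      ← Set.ncard_eq_toFinset_card', ncard_coe_addSubgroup] at h2
    have h3 : (termsIn X.val H).card = (X.filter (· ∈ H)).card := by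
      rw [Finset.card_def, Finset.filter_val, termsIn]
    omega
  have hn0 : 0 < n := hker ▸ Nat.card_pos
  have hb := ht X.val hreg (by rw [Finset.card_val, hXc]; omega)
  obtain ⟨g, hg⟩ := hχ (-1)
  obtain ⟨T, hT, -, hTs⟩ : g ∈ subseqSums X.val := by
    rw [hb]; exact Set.mem_univ g
  have hχsum : ∀ T : Multiset G, T ≤ X.val →
      χ T.sum = ((T.filter (· ∈ F)).card : ZMod p) := by
    intro T
    induction T using Multiset.induction_on with
    | empty => simp
    | cons a T ih =>
      intro hle
      have ha : a ∈ X := Multiset.mem_of_le hle (Multiset.mem_cons_self _ _)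
      rw [Multiset.sum_cons, map_add, ih ((Multiset.le_cons_self _ _).trans hle)]
      by_cases haF : a ∈ F
      · rw [Multiset.filter_cons_of_pos _ haF, hF1 a haF, Multiset.card_cons]
        push_cast; ring
      · have : χ a = 0 := by
          rcases Finset.mem_union.1 ha with h | h
          · exact (Finset.mem_filter.1 (Finset.mem_of_mem_erase h)).2
          · exact absurd h haF
        rw [Multiset.filter_cons_of_neg _ haF, this, zero_add]
  have h1 := hχsum T hT
  rw [hTs, hg] at h1
  have h2 : (T.filter (· ∈ F)).card ≤ p - 2 := by
    rw [← hFc, Finset.card_def]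
    refine Multiset.card_le_card ?_
    rw [Multiset.le_iff_subset (Multiset.Nodup.filter _ (Multiset.nodup_of_le hT X.nodup))]
    intro x hx
    exact (Multiset.mem_filter.1 hx).2
  have h3 : (((T.filter (· ∈ F)).card + 1 : ℕ) : ZMod p) = 0 := by
    push_cast; rw [← h1]; ring
  rw [ZMod.natCast_eq_zero_iff] at h3
  have := Nat.le_of_dvd (by omega) h3
  omega

theorem theorem1p1 {G : Type*} [AddCommGroup G] [Finite G] (n₁ n₂ p : ℕ)
    (hG : Nonempty (G ≃+ ZMod n₁ × ZMod n₂)) (hdvd : n₁ ∣ n₂)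
    (hp : IsLeast {q : ℕ | q.Prime ∧ q ∣ Nat.card G} p) (hp3 : 3 ≤ p)
    (hn₁ : 2 * p ≤ n₁) (hcard : 72 * p ^ 6 ≤ Nat.card G) :
    IsLeast (basisLengths G) (c0 G) ∧ c0 G = Nat.card G / p + p - 2 := by
  obtain ⟨φ⟩ := hG
  obtain ⟨⟨hpp, hpG⟩, hpmin⟩ := hp
  have : Fact p.Prime := ⟨hpp⟩
  have hmin : ∀ q : ℕ, q.Prime → q ∣ Nat.card G → p ≤ q := fun q hq hqG => hpmin ⟨hq, hqG⟩
  have hcardG : Nat.card G = n₁ * n₂ := by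
    rw [Nat.card_congr φ.toEquiv, Nat.card_prod, Nat.card_zmod, Nat.card_zmod]
  have hGpos : 0 < Nat.card G := Nat.card_pos
  have hn₂ : 0 < n₂ := Nat.pos_of_ne_zero (by rintro rfl; rw [mul_zero] at hcardG; omega)
  -- `n₁` is odd because the smallest prime divisor of `|G|` is odd
  have hn₁' : 2 * p + 1 ≤ n₁ := by
    rcases hn₁.lt_or_eq with h | h
    · exact h
    · have := hmin 2 Nat.prime_two (by rw [hcardG, ← h, mul_assoc]; exact dvd_mul_right _ _)
      omega
  have he : ∀ x : G, addOrderOf x ≤ n₂ := fun x => by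
    refine addOrderOf_le_of_nsmul_eq_zero hn₂ (φ.injective ?_)
    rw [map_nsmul, map_zero]
    refine Prod.ext ?_ ?_
    · rw [Prod.smul_fst, nsmul_eq_mul, (ZMod.natCast_eq_zero_iff _ _).2 hdvd, zero_mul]; rfl
    · rw [Prod.smul_snd, nsmul_eq_mul, ZMod.natCast_self, zero_mul]; rfl
  have hpn₂ : p ∣ n₂ := by
    rw [hcardG] at hpG
    rcases hpp.dvd_mul.1 hpG with h | h
    · exact h.trans hdvd
    · exact h
  have hnp : Nat.card G / p * p = Nat.card G := Nat.div_mul_cancel hpG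
  have hple : p ≤ Nat.card G / p := by
    rw [Nat.le_div_iff_mul_le hpp.pos]
    have h1 : p * p ≤ p ^ 6 := by
      rw [← sq]; exact Nat.pow_le_pow_right hpp.pos (by norm_num)
    omega
  let χ : G →+ ZMod p :=
    ((ZMod.castHom hpn₂ (ZMod p)).toAddMonoidHom.comp (AddMonoidHom.snd _ _)).comp φ.toAddMonoidHom
  have hχ : Function.Surjective χ :=
    ((ZMod.castHom_surjective hpn₂).comp Prod.snd_surjective).comp φ.surjective
  have hleast : IsLeast (basisLengths G) (Nat.card G / p + p - 2) := by
    constructor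
    · intro S hS hlen
      refine isAdditiveBasis_of_isRegularSeq hp3 hmin he ?_ hcard hnp hS (by omega)
      rw [hcardG, mul_comm]
      exact Nat.mul_le_mul_right _ hn₁'
    · intro t ht
      exact le_of_mem_basisLengths hnp (by omega) χ hχ ht
  have hc0 : c0 G = Nat.card G / p + p - 2 := hleast.csInf_eq
  exact ⟨hc0 ▸ hleast, hc0⟩
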